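/- Let $d \ge 0$ be an integer. Let $\hat u$ denote the Fourier transform (normalized by $\hat f(\xi) = \int f(x) e^{-2\pi i x\cdot \xi}\,dx$) on the space $\mathscr S'(\mathbb R^d)$ of tempered distributions, and let $\langle \xi\rangle = \sqrt{1+|\xi|^2}$. For an integer $k \ge 0$ let $W^{k,2}(\mathbb R^d)$ be the Banach space of all $u \in \mathscr S'(\mathbb R^d)$ such that the distributional derivative $D^\alpha u$ belongs to $L^2(\mathbb R^d)$ for every multi-index $|\alpha| \le k$, with norm $\|u\|_{W^{k,2}} = \big(\sum_{|\alpha|\le k} \|D^\alpha u\|_2^2\big)^{1/2}$. For real $s \ge 0$ let $H^s(\mathbb R^d)$ be the space of all $u \in \mathscr S'(\mathbb R^d)$ with $\langle \xi\rangle^s \hat u \in L^2(\mathbb R^d)$, with norm $\|u\|_{H^s} = \|\langle\xi\rangle^s \hat u\|_2$. For a complex Banach couple $(B_0,B_1)$ (two complex Banach spaces continuously embedded in a common Hausdorff topological vector space), let $\mathcal F(B_0,B_1)$ be the set of all functions $f$ from the strip $\{0 \le \operatorname{Re} z \le 1\}$ to $B_0+B_1$, where $\|v\|_{B_0+B_1}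 = \inf_{v=v_0+v_1}(\|v_0\|_{B_0}+\|v_1\|_{B_1})$, which are continuous and bounded on the strip, holomorphic in its interior (that is, $l\circ f$ is holomorphic for every bounded linear functional $l$ on $B_0+B_1$), and such that for $j = 0,1$ the function $y \mapsto f(j+iy)$ is a continuous function from $\mathbb R$ to $B_j$ that tends to $0$ in $B_j$ as $|y|\to\infty$. Put $\|f\|_{\mathcal F} = \max\{\sup_y \|f(iy)\|_{B_0}, \sup_y\|f(1+iy)\|_{B_1}\}$. For $\theta\in[0,1]$ let $$[B_0,B_1]_\theta = \{f(\theta) : f \in \mathcal F(B_0,B_1)\}, \qquad \|v\|_\theta = \inf\{\|f\|_{\mathcal F} : f\in\mathcal F(B_0,B_1),\ f(\theta)=v\}.$$ For real $s \ge 0$, the space $W^{s,2}(\mathbb R^d)$ is $[W^{k,2}(\mathbb R^d), W^{k+1,2}(\mathbb R^d)]_\theta$, where $k \ge 0$ is an integer with $k \le s \le k+1$, and $\theta \in [0,1]$ is given by $s = (1-\theta)k + \theta(k+1)$. **Theorem.** For every real $s \ge 0$, $$W^{s,2}(\mathbb R^d) = H^s(\mathbb R^d)$$ as spaces of tempered distributions,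 with equivalent norms. This holds for every admissible choice of $k$ and $\theta$ in the definition of $W^{s,2}$, and, when $s = k$ is an integer, also for the space $W^{k,2}(\mathbb R^d)$ defined directly by distributional derivatives. -/

import Mathlib

open MeasureTheory TopologicalSpace Filter Topology FourierTransform
open scoped SchwartzMap ENNReal LineDeriv ZeroAtInfty

noncomputable section

/-! ### Complex interpolation of Banach couples -/

/-- A complex Banach couple: two complex Banach spaces `B₀`, `B₁` together with continuous
embeddings into a common Hausdorff topological vector space `V`. -/
structure BanachCouple (B₀ B₁ V : Type*)
    [NormedAddCommGroup B₀] [NormedSpace ℂ B₀] [CompleteSpace B₀]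
    [NormedAddCommGroup B₁] [NormedSpace ℂ B₁] [CompleteSpace B₁]
    [AddCommGroup V] [Module ℂ V] [TopologicalSpace V] [T2Space V]
    [IsTopologicalAddGroup V] [ContinuousSMul ℂ V] where
  /-- The embedding of `B₀` into the ambient space. -/
  i₀ : B₀ →L[ℂ] V
  /-- The embedding of `B₁` into the ambient space. -/
  i₁ : B₁ →L[ℂ] V
  inj₀ : Function.Injective i₀
  inj₁ : Function.Injective i₁

namespace BanachCouple

variable {B₀ B₁ V : Type*}
  [NormedAddCommGroup B₀] [NormedSpace ℂ B₀] [CompleteSpace B₀]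
  [NormedAddCommGroup B₁] [NormedSpace ℂ B₁] [CompleteSpace B₁]
  [AddCommGroup V] [Module ℂ V] [TopologicalSpace V] [T2Space V]
  [IsTopologicalAddGroup V] [ContinuousSMul ℂ V]

/-- The map `(b₀, b₁) ↦ b₀ + b₁` from `B₀ × B₁`, normed by `‖b₀‖ + ‖b₁‖`, to the ambient space. -/
def addMap (C : BanachCouple B₀ B₁ V) : WithLp 1 (B₀ × B₁) →L[ℂ] V :=
  (C.i₀.coprod C.i₁).comp
    (WithLp.prodContinuousLinearEquiv 1 ℂ B₀ B₁ : WithLp 1 (B₀ × B₁) →L[ℂ] B₀ × B₁)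

/-- The pairs `(b₀, b₁)` with `b₀ + b₁ = 0` in the ambient space. -/
def addKer (C : BanachCouple B₀ B₁ V) : Submodule ℂ (WithLp 1 (B₀ × B₁)) :=
  LinearMap.ker (C.addMap : WithLp 1 (B₀ × B₁) →ₗ[ℂ] V)

instance isClosed_addKer (C : BanachCouple B₀ B₁ V) :
    IsClosed (C.addKer : Set (WithLp 1 (B₀ × B₁))) :=
  C.addMap.isClosed_ker

/-- The sum `B₀ + B₁`. As a quotient of `B₀ × B₁` (with norm `‖b₀‖ + ‖b₁‖`) it carries the norm
`‖v‖ = inf {‖b₀‖ + ‖b₁‖ : v = b₀ + b₁}`. -/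
abbrev SumSpace (C : BanachCouple B₀ B₁ V) : Type _ := WithLp 1 (B₀ × B₁) ⧸ C.addKer

/-- The element `b₀ + b₁` of `B₀ + B₁`. -/
def ofPair (C : BanachCouple B₀ B₁ V) (b₀ : B₀) (b₁ : B₁) : C.SumSpace :=
  C.addKer.mkQ (WithLp.toLp 1 (b₀, b₁))

/-- The inclusion of `B₀ + B₁` in the ambient space. -/
def toAmbient (C : BanachCouple B₀ B₁ V) : C.SumSpace →ₗ[ℂ] V :=
  C.addKer.liftQ (C.addMap : WithLp 1 (B₀ × B₁) →ₗ[ℂ] V) le_rfl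

theorem toAmbient_ofPair (C : BanachCouple B₀ B₁ V) (b₀ : B₀) (b₁ : B₁) :
    C.toAmbient (C.ofPair b₀ b₁) = C.i₀ b₀ + C.i₁ b₁ := by
  simp [toAmbient, ofPair, addMap]

theorem toAmbient_injective (C : BanachCouple B₀ B₁ V) : Function.Injective C.toAmbient := by
  rw [← LinearMap.ker_eq_bot]
  exact Submodule.ker_liftQ_eq_bot _ _ _ le_rfl

/-- The closed strip `0 ≤ Re z ≤ 1`. -/
def strip : Set ℂ := {z | 0 ≤ z.re ∧ z.re ≤ 1}

/-- The interior `0 < Re z < 1` of the strip. -/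
def openStrip : Set ℂ := {z | 0 < z.re ∧ z.re < 1}

/-- The space `𝓕(B₀, B₁)` of functions on the strip with values in `B₀ + B₁` that are continuous
and bounded on the closed strip, (weakly) holomorphic in its interior, and that on the line
`Re z = 0` (resp. `Re z = 1`) are given by a continuous `B₀`-valued (resp. `B₁`-valued) function
vanishing at infinity. The boundary values are determined by `toFun` because the embeddings are
injective; they are recorded as data, as elements of `C₀(ℝ, B₀)` and `C₀(ℝ, B₁)`.
Values of `toFun` off the strip are irrelevant. -/
structure StripFunction (C : BanachCouple B₀ B₁ V) where
  toFun : ℂ → C.SumSpace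
  bdry₀ : C₀(ℝ, B₀)
  bdry₁ : C₀(ℝ, B₁)
  continuousOn : ContinuousOn toFun strip
  bounded : ∃ M : ℝ, ∀ z ∈ strip, ‖toFun z‖ ≤ M
  holomorphic : ∀ l : C.SumSpace →L[ℂ] ℂ, DifferentiableOn ℂ (fun z => l (toFun z)) openStrip
  eq_bdry₀ : ∀ y : ℝ, toFun (Complex.I * y) = C.ofPair (bdry₀ y) 0
  eq_bdry₁ : ∀ y : ℝ, toFun (1 + Complex.I * y) = C.ofPair 0 (bdry₁ y)

/-- `‖f‖_𝓕 = max (sup_y ‖f(iy)‖_{B₀}) (sup_y ‖f(1+iy)‖_{B₁})`. -/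
def StripFunction.fNorm {C : BanachCouple B₀ B₁ V} (f : C.StripFunction) : ℝ :=
  max (⨆ y : ℝ, ‖f.bdry₀ y‖) (⨆ y : ℝ, ‖f.bdry₁ y‖)

/-- The complex interpolation space `[B₀, B₁]_θ`, as a subspace of the ambient space: all
`v = f(θ)` with `f ∈ 𝓕(B₀, B₁)`. -/
def interp (C : BanachCouple B₀ B₁ V) (θ : ℝ) : Submodule ℂ V where
  carrier := {v | ∃ f : C.StripFunction, C.toAmbient (f.toFun θ) = v}
  zero_mem' := ⟨{ toFun := fun _ => 0
                  bdry₀ := 0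
                  bdry₁ := 0
                  continuousOn := continuousOn_const
                  bounded := ⟨0, fun _ _ => by simp⟩
                  holomorphic := fun l => by simp
                  eq_bdry₀ := fun y => by
                    apply C.toAmbient_injective
                    simp [toAmbient_ofPair]
                  eq_bdry₁ := fun y => by
                    apply C.toAmbient_injective
                    simp [toAmbient_ofPair] }, by simp⟩
  add_mem' := by
    rintro _ _ ⟨f, rfl⟩ ⟨g, rfl⟩
    refine ⟨{ toFun := fun z => f.toFun z + g.toFun z
              bdry₀ := f.bdry₀ + g.bdry₀
              bdry₁ := f.bdry₁ + g.bdry₁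
              continuousOn := f.continuousOn.add g.continuousOn
              bounded := ?_
              holomorphic := fun l => by
                simpa using (f.holomorphic l).fun_add (g.holomorphic l)
              eq_bdry₀ := fun y => by
                apply C.toAmbient_injective
                simp [toAmbient_ofPair, f.eq_bdry₀, g.eq_bdry₀]
              eq_bdry₁ := fun y => by
                apply C.toAmbient_injective
                simp [toAmbient_ofPair, f.eq_bdry₁, g.eq_bdry₁] }, by simp⟩
    obtain ⟨M, hM⟩ := f.bounded
    obtain ⟨N, hN⟩ := g.bounded
    exact ⟨M + N, fun z hz => (norm_add_le _ _).trans (add_le_add (hM z hz) (hN z hz))⟩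
  smul_mem' := by
    rintro c _ ⟨f, rfl⟩
    refine ⟨{ toFun := fun z => c • f.toFun z
              bdry₀ := c • f.bdry₀
              bdry₁ := c • f.bdry₁
              continuousOn := f.continuousOn.const_smul c
              bounded := ?_
              holomorphic := fun l => by
                simpa using (f.holomorphic l).const_mul c
              eq_bdry₀ := fun y => by
                apply C.toAmbient_injective
                simp [toAmbient_ofPair, f.eq_bdry₀]
              eq_bdry₁ := fun y => by
                apply C.toAmbient_injective
                simp [toAmbient_ofPair, f.eq_bdry₁] }, by simp⟩
    obtain ⟨M, hM⟩ := f.bounded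
    refine ⟨‖c‖ * M, fun z hz => ?_⟩
    rw [norm_smul]
    exact mul_le_mul_of_nonneg_left (hM z hz) (norm_nonneg c)

/-- The norm of `[B₀, B₁]_θ`: the infimum of `‖f‖_𝓕` over all `f ∈ 𝓕(B₀, B₁)` with
`f(θ) = v`. Only meaningful for `v` in `C.interp θ`. -/
def interpNorm (C : BanachCouple B₀ B₁ V) (θ : ℝ) (v : V) : ℝ :=
  sInf {r | ∃ f : C.StripFunction, C.toAmbient (f.toFun θ) = v ∧ f.fNorm = r}

end BanachCouple

/-! ### Sobolev spaces of integer order -/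

/-- `d`-dimensional Euclidean space. -/
abbrev Rd (d : ℕ) : Type := EuclideanSpace ℝ (Fin d)

/-- The multi-indices `α ∈ ℕ^d` with `|α| = α₁ + ... + α_d ≤ k`. -/
abbrev MultiIndex (d k : ℕ) : Type := {α : Fin d → Fin (k + 1) // ∑ i, (α i : ℕ) ≤ k}

/-- The partial derivative `D^α = ∂₁^{α₁} ⋯ ∂_d^{α_d}` of tempered distributions. -/
def weakDeriv {d : ℕ} (α : Fin d → ℕ) : 𝓢'(Rd d, ℂ) →L[ℂ] 𝓢'(Rd d, ℂ) :=
  (List.ofFn fun i : Fin d =>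
    (LineDeriv.lineDerivOpCLM ℂ 𝓢'(Rd d, ℂ) (EuclideanSpace.single i (1 : ℝ))) ^ α i).prod

/-- The embedding of `L^p(ℝ^d)` into the tempered distributions. -/
abbrev lpEmb (d : ℕ) (p : ℝ≥0∞) [Fact (1 ≤ p)] :
    Lp ℂ p (volume : Measure (Rd d)) →L[ℂ] 𝓢'(Rd d, ℂ) :=
  Lp.toTemperedDistributionCLM ℂ volume p

theorem lpEmb_injective (d : ℕ) (p : ℝ≥0∞) [Fact (1 ≤ p)] :
    Function.Injective (lpEmb d p) :=
  LinearMap.ker_eq_bot.mp Lp.ker_toTemperedDistributionCLM_eq_bot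

/-- `W^{k,p}(ℝ^d)` as a space of tempered distributions: all `u` such that `D^α u ∈ L^p` for every
`|α| ≤ k`. -/
def sobolevSubmodule (d k : ℕ) (p : ℝ≥0∞) [Fact (1 ≤ p)] : Submodule ℂ 𝓢'(Rd d, ℂ) where
  carrier := {u | ∀ α : MultiIndex d k,
    ∃ g : Lp ℂ p (volume : Measure (Rd d)), weakDeriv (fun i => (α.1 i : ℕ)) u = lpEmb d p g}
  zero_mem' := fun _ => ⟨0, by simp only [map_zero]⟩
  add_mem' := by
    intro u v hu hv α
    obtain ⟨g, hg⟩ := hu α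
    obtain ⟨h, hh⟩ := hv α
    exact ⟨g + h, by simp only [map_add, hg, hh]⟩
  smul_mem' := by
    intro c u hu α
    obtain ⟨g, hg⟩ := hu α
    exact ⟨c • g, by simp only [map_smul, hg]⟩

/-- `W^{k,p}(ℝ^d)` as a type of its own, to be equipped with its norm. -/
def SobolevSpace (d k : ℕ) (p : ℝ≥0∞) [Fact (1 ≤ p)] : Type := sobolevSubmodule d k p

namespace SobolevSpace

variable {d k : ℕ} {p : ℝ≥0∞} [Fact (1 ≤ p)]

instance : AddCommGroup (SobolevSpace d k p) :=
  inferInstanceAs (AddCommGroup (sobolevSubmodule d k p))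

instance : Module ℂ (SobolevSpace d k p) :=
  inferInstanceAs (Module ℂ (sobolevSubmodule d k p))

/-- The inclusion of `W^{k,p}` in the tempered distributions. -/
def incl (d k : ℕ) (p : ℝ≥0∞) [Fact (1 ≤ p)] : SobolevSpace d k p →ₗ[ℂ] 𝓢'(Rd d, ℂ) :=
  (sobolevSubmodule d k p).subtype

theorem incl_injective : Function.Injective (incl d k p) :=
  Subtype.val_injective

theorem range_incl : LinearMap.range (incl d k p) = sobolevSubmodule d k p :=
  Submodule.range_subtype _

/-- The `L^p` function representing `D^α u`. -/
def derivLp (u : SobolevSpace d k p) (α : MultiIndex d k) : Lp ℂ p (volume : Measure (Rd d)) :=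
  (u.2 α).choose

theorem lpEmb_derivLp (u : SobolevSpace d k p) (α : MultiIndex d k) :
    lpEmb d p (u.derivLp α) = weakDeriv (fun i => (α.1 i : ℕ)) (incl d k p u) :=
  (u.2 α).choose_spec.symm

/-- The map `u ↦ (D^α u)_{|α| ≤ k}` into the `ℓ^p`-sum of copies of `L^p`. -/
def jet (d k : ℕ) (p : ℝ≥0∞) [Fact (1 ≤ p)] :
    SobolevSpace d k p →ₗ[ℂ]
      PiLp p (fun _ : MultiIndex d k => Lp ℂ p (volume : Measure (Rd d))) where
  toFun u := WithLp.toLp p u.derivLp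
  map_add' u v := by
    ext1 α
    apply lpEmb_injective d p
    rw [PiLp.add_apply, map_add]
    simp only [lpEmb_derivLp, map_add]
  map_smul' c u := by
    ext1 α
    apply lpEmb_injective d p
    rw [RingHom.id_apply, PiLp.smul_apply, map_smul]
    simp only [lpEmb_derivLp, map_smul]

/-- The multi-index `0`. -/
def zeroIndex (d k : ℕ) : MultiIndex d k := ⟨0, by simp⟩

theorem weakDeriv_zeroIndex (u : 𝓢'(Rd d, ℂ)) :
    weakDeriv (fun i => ((zeroIndex d k).1 i : ℕ)) u = u := by
  simp [weakDeriv, zeroIndex]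

theorem lpEmb_jet_zero (u : SobolevSpace d k p) :
    lpEmb d p (jet d k p u (zeroIndex d k)) = incl d k p u :=
  (lpEmb_derivLp u _).trans (weakDeriv_zeroIndex _)

theorem jet_injective : Function.Injective (jet d k p) := by
  intro u v h
  apply incl_injective
  rw [← lpEmb_jet_zero, ← lpEmb_jet_zero, h]

/-- The norm of `W^{k,p}` is `(∑_{|α| ≤ k} ‖D^α u‖_p^p)^{1/p}`. -/
instance : NormedAddCommGroup (SobolevSpace d k p) :=
  NormedAddCommGroup.induced _ _ (jet d k p) jet_injective

instance : NormedSpace ℂ (SobolevSpace d k p) :=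
  NormedSpace.induced ℂ _ _ (jet d k p)

theorem norm_eq_sum (hp : p ≠ ∞) (u : SobolevSpace d k p) :
    ‖u‖ = (∑ α : MultiIndex d k, ‖u.derivLp α‖ ^ p.toReal) ^ (1 / p.toReal) :=
  PiLp.norm_eq_sum
    (ENNReal.toReal_pos (zero_lt_one.trans_le (Fact.out : 1 ≤ p)).ne' hp) (jet d k p u)

theorem isometry_jet : Isometry (jet d k p) :=
  AddMonoidHomClass.isometry_of_norm _ fun _ => rfl

/-- The inclusion of `W^{k,p}` in the tempered distributions is continuous. -/
def inclCLM (d k : ℕ) (p : ℝ≥0∞) [Fact (1 ≤ p)] : SobolevSpace d k p →L[ℂ] 𝓢'(Rd d, ℂ) where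
  toLinearMap := incl d k p
  cont := by
    have h : (fun u => incl d k p u) =
        fun u => lpEmb d p (jet d k p u (zeroIndex d k)) := by
      funext u
      exact (lpEmb_jet_zero u).symm
    change Continuous (fun u => incl d k p u)
    rw [h]
    exact (lpEmb d p).continuous.comp
      ((PiLp.continuous_apply p _ (zeroIndex d k)).comp isometry_jet.continuous)

theorem range_jet : Set.range (jet d k p) =
    {w | ∀ α : MultiIndex d k,
      lpEmb d p (w α) = weakDeriv (fun i => (α.1 i : ℕ)) (lpEmb d p (w (zeroIndex d k)))} := by
  ext w
  constructor
  · rintro ⟨u, rfl⟩ α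
    rw [lpEmb_jet_zero]
    exact lpEmb_derivLp u α
  · intro hw
    let u : SobolevSpace d k p :=
      ⟨lpEmb d p (w (zeroIndex d k)), fun α => ⟨w α, (hw α).symm⟩⟩
    refine ⟨u, ?_⟩
    ext1 α
    apply lpEmb_injective d p
    exact (lpEmb_derivLp u α).trans (hw α).symm

instance : CompleteSpace (SobolevSpace d k p) := by
  have hc : IsClosed (Set.range (jet d k p)) := by
    rw [range_jet, Set.ofPred_forall]
    refine isClosed_iInter fun α => isClosed_eq ?_ ?_
    · exact (lpEmb d p).continuous.comp (PiLp.continuous_apply p _ α)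
    · exact (weakDeriv _).continuous.comp
        ((lpEmb d p).continuous.comp (PiLp.continuous_apply p _ (zeroIndex d k)))
  exact (completeSpace_iff_isComplete_range isometry_jet.isUniformInducing).mpr hc.isComplete

end SobolevSpace

instance continuousSMul_temperedDistribution (d : ℕ) : ContinuousSMul ℂ 𝓢'(Rd d, ℂ) :=
  UniformConvergenceCLM.continuousSMul (RingHom.id ℂ) ℂ {S : Set 𝓢(Rd d, ℂ) | Finite S}
    fun _ hS => Set.Finite.isVonNBounded hS

/-- The Banach couple `(W^{k,p}(ℝ^d), W^{k+1,p}(ℝ^d))` inside the tempered distributions. -/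
def sobolevCouple (d k : ℕ) (p : ℝ≥0∞) [Fact (1 ≤ p)] :
    BanachCouple (SobolevSpace d k p) (SobolevSpace d (k + 1) p) 𝓢'(Rd d, ℂ) where
  i₀ := SobolevSpace.inclCLM d k p
  i₁ := SobolevSpace.inclCLM d (k + 1) p
  inj₀ := SobolevSpace.incl_injective
  inj₁ := SobolevSpace.incl_injective

/-! ### The spaces `H^s` -/

/-- `⟨ξ⟩ = √(1 + |ξ|²)`. -/
def japaneseBracket {d : ℕ} (ξ : Rd d) : ℝ := √(1 + ‖ξ‖ ^ 2)

theorem japaneseBracket_rpow {d : ℕ} (s : ℝ) (ξ : Rd d) :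
    japaneseBracket ξ ^ s = (1 + ‖ξ‖ ^ 2) ^ (s / 2) := by
  rw [japaneseBracket, Real.sqrt_eq_rpow, ← Real.rpow_mul (by positivity)]
  congr 1
  ring

theorem hasTemperateGrowth_japaneseBracket_rpow (d : ℕ) (s : ℝ) :
    (fun ξ : Rd d => ((japaneseBracket ξ ^ s : ℝ) : ℂ)).HasTemperateGrowth := by
  simp only [japaneseBracket_rpow]
  fun_prop

/-- The tempered distribution `⟨ξ⟩^s û`. -/
def weightedFourier (d : ℕ) (s : ℝ) (u : 𝓢'(Rd d, ℂ)) : 𝓢'(Rd d, ℂ) :=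
  TemperedDistribution.smulLeftCLM ℂ (fun ξ : Rd d => ((japaneseBracket ξ ^ s : ℝ) : ℂ)) (𝓕 u)

/-- `H^s(ℝ^d)`: the tempered distributions `u` with `⟨ξ⟩^s û ∈ L²(ℝ^d)`. -/
def hSubmodule (d : ℕ) (s : ℝ) : Submodule ℂ 𝓢'(Rd d, ℂ) where
  carrier := {u | ∃ g : Lp ℂ 2 (volume : Measure (Rd d)), weightedFourier d s u = lpEmb d 2 g}
  zero_mem' := ⟨0, by
    simp only [weightedFourier, FourierTransform.fourier_zero, map_zero]⟩
  add_mem' := by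
    rintro u v ⟨g, hg⟩ ⟨h, hh⟩
    refine ⟨g + h, ?_⟩
    rw [map_add, ← hg, ← hh]
    simp only [weightedFourier, FourierTransform.fourier_add, map_add]
  smul_mem' := by
    rintro c u ⟨g, hg⟩
    refine ⟨c • g, ?_⟩
    rw [map_smul, ← hg]
    simp only [weightedFourier, FourierTransform.fourier_smul, map_smul]

/-- The norm `‖u‖_{H^s} = ‖⟨ξ⟩^s û‖_{L²}` of an element of `H^s`. -/
def hNorm {d : ℕ} {s : ℝ} (u : hSubmodule d s) : ℝ :=
  ‖(u.2.choose : Lp ℂ 2 (volume : Measure (Rd d)))‖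

theorem hNorm_eq {d : ℕ} {s : ℝ} (u : hSubmodule d s) (g : Lp ℂ 2 (volume : Measure (Rd d)))
    (hg : weightedFourier d s u = lpEmb d 2 g) : hNorm u = ‖g‖ := by
  rw [hNorm, lpEmb_injective d 2 (u.2.choose_spec.symm.trans hg)]

end

/-! After Fourier transform every space involved becomes a weighted `L²` space. By Plancherel, `D^α`
is multiplication by `(2πiξ)^α`, and `∑_{|α| ≤ k} |(2πiξ)^α|` is comparable with `⟨ξ⟩^k`; hence
`W^{k,2}` consists of the `u` with `û = ⟨ξ⟩^{-k} g`, `g ∈ L²`, with comparable norms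
(`norm_sobolevLift_le`, `exists_fourier_incl_eq_bracketOp`). Membership in `H^s` is likewise
expressed as `û = ⟨ξ⟩^{-s} g`, so that only the bounded multipliers `⟨ξ⟩^{-z}` with `0 ≤ Re z`
occur.

For `H^{k+θ} ⊆ [W^{k,2}, W^{k+1,2}]_θ`, let `û = ⟨ξ⟩^{-k-θ} g` and take the curve `exp((z-θ)²)
𝓕⁻¹(⟨ξ⟩^{-k-z} g)`. Imaginary powers of `⟨ξ⟩` are unimodular, so the curve is bounded in `W^{k+j,2}`
on `Re z = j`; the Gaussian factor gives decay and equals `1` at `θ` (`liftStripFunction`).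

Conversely, multiply the Fourier transform of a strip function by `⟨ξ⟩^{k+z}`, with `log ⟨ξ⟩` cut
off at `n` to keep the multiplier bounded and entire in `z`. On both boundary lines the `L²` norm is
at most a constant times `‖f‖_𝓕`, uniformly in `n`. Hadamard's three lines theorem carries this to
`θ`, and Fatou's lemma removes the cutoff (`exists_fourier_eq_of_stripFunction`,
`exists_bracketOp_eq_of_bound`). -/

/-! ### Multiplication operators on `L²` -/

/-- The space `L²(ℝ^d)`. -/
abbrev LTwo (d : ℕ) : Type := Lp ℂ 2 (volume : Measure (Rd d))

open Classical in
/-- Multiplication by a function `m ∈ L^∞`, as an operator on `L²`. -/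
noncomputable def mulOp {d : ℕ} (m : Rd d → ℂ) : LTwo d →L[ℂ] LTwo d :=
  if h : MemLp m ∞ (volume : Measure (Rd d)) then
    (ContinuousLinearMap.mul ℂ ℂ).holderL volume ∞ 2 2 h.toLp
  else 0

section mulOp

variable {d : ℕ} {m m' : Rd d → ℂ}

theorem coeFn_mulOp (hm : MemLp m ∞ volume) (g : LTwo d) :
    mulOp m g =ᵐ[volume] fun ξ => m ξ * g ξ := by
  rw [mulOp, dif_pos hm]
  have h := (ContinuousLinearMap.mul ℂ ℂ).coeFn_holder (r := 2) (μ := volume) hm.toLp g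
  filter_upwards [h, hm.coeFn_toLp] with ξ h₁ h₂
  refine h₁.trans ?_
  rw [h₂]
  rfl

theorem mulOp_eq_toLp_smul (hm : MemLp m ∞ volume) (g : LTwo d) :
    mulOp m g = (hm.toLp • g : LTwo d) := by
  apply Lp.ext
  filter_upwards [coeFn_mulOp hm g, Lp.coeFn_lpSMul (r := 2) hm.toLp g, hm.coeFn_toLp]
    with ξ h₁ h₂ h₃
  rw [h₁, h₂, Pi.smul_apply', h₃, smul_eq_mul]

theorem lpEmb_mulOp (hm : MemLp m ∞ volume) (hm' : m.HasTemperateGrowth) (g : LTwo d) :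
    lpEmb d 2 (mulOp m g) = TemperedDistribution.smulLeftCLM ℂ m (lpEmb d 2 g) := by
  rw [mulOp_eq_toLp_smul hm]
  exact Lp.toTemperedDistribution_smul_eq hm' hm g

theorem mulOp_mulOp (hm : MemLp m ∞ volume) (hm' : MemLp m' ∞ volume)
    {m'' : Rd d → ℂ} (hm'' : MemLp m'' ∞ volume) (h : ∀ ξ, m ξ * m' ξ = m'' ξ) (g : LTwo d) :
    mulOp m (mulOp m' g) = mulOp m'' g := by
  apply Lp.ext
  filter_upwards [coeFn_mulOp hm (mulOp m' g), coeFn_mulOp hm' g, coeFn_mulOp hm'' g]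
    with ξ h₁ h₂ h₃
  rw [h₁, h₂, h₃, ← h, mul_assoc]

theorem norm_mulOp_apply_le (hm : MemLp m ∞ volume) {C : ℝ} (hC : ∀ ξ, ‖m ξ‖ ≤ C) (g : LTwo d) :
    ‖mulOp m g‖ ≤ C * ‖g‖ := by
  refine Lp.norm_le_mul_norm_of_ae_le_mul ?_
  filter_upwards [coeFn_mulOp hm g] with ξ h
  rw [h, norm_mul]
  gcongr
  exact hC ξ

end mulOp

/-! ### Exponential symbols -/

section expSymbol

variable {d : ℕ} {a : Rd d → ℝ}

/-- The symbol `exp (z a(ξ))`. -/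
noncomputable def expSymbol (a : Rd d → ℝ) (z : ℂ) (ξ : Rd d) : ℂ := Complex.exp (z * a ξ)

theorem norm_expSymbol (a : Rd d → ℝ) (z : ℂ) (ξ : Rd d) :
    ‖expSymbol a z ξ‖ = Real.exp (z.re * a ξ) := by
  simp [expSymbol, Complex.norm_exp]

theorem measurable_expSymbol (ha : Measurable a) (z : ℂ) : Measurable (expSymbol a z) := by
  unfold expSymbol
  fun_prop

theorem norm_expSymbol_le {A : ℝ} (hA : ∀ ξ, |a ξ| ≤ A) (z : ℂ) (ξ : Rd d) :
    ‖expSymbol a z ξ‖ ≤ Real.exp (|z.re| * A) := by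
  rw [norm_expSymbol, Real.exp_le_exp]
  calc z.re * a ξ ≤ |z.re * a ξ| := le_abs_self _
    _ = |z.re| * |a ξ| := abs_mul _ _
    _ ≤ |z.re| * A := by gcongr; exact hA ξ

theorem memLp_expSymbol {A : ℝ} (ha : Measurable a) (hA : ∀ ξ, |a ξ| ≤ A) (z : ℂ) :
    MemLp (expSymbol a z) ∞ volume :=
  memLp_top_of_bound (measurable_expSymbol ha z).aestronglyMeasurable _
    (.of_forall (norm_expSymbol_le hA z))

theorem norm_exp_sub_exp_sub_le {w z : ℂ} (hw : ‖w‖ ≤ 1) :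
    ‖Complex.exp (z + w) - Complex.exp z - w * Complex.exp z‖ ≤ ‖Complex.exp z‖ * ‖w‖ ^ 2 := by
  have h : Complex.exp (z + w) - Complex.exp z - w * Complex.exp z =
      Complex.exp z * (Complex.exp w - 1 - w) := by
    rw [Complex.exp_add]; ring
  rw [h, norm_mul]
  gcongr
  exact Complex.norm_exp_sub_one_sub_id_le hw

/-- Since `a` is bounded, the second-order Taylor remainder of `exp` is `O(|z - z₀|²)` uniformly in
`ξ`, which gives a derivative in operator norm. This is why `log ⟨ξ⟩` is truncated before the lemma
is applied. -/
theorem hasDerivAt_mulOp_expSymbol {A : ℝ} (ha : Measurable a) (hA : ∀ ξ, |a ξ| ≤ A) (z₀ : ℂ) :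
    HasDerivAt (fun z => mulOp (expSymbol a z))
      (mulOp (fun ξ => a ξ * expSymbol a z₀ ξ)) z₀ := by
  have hA0 : 0 ≤ A := (abs_nonneg _).trans (hA 0)
  have hD : MemLp (fun ξ => (a ξ : ℂ) * expSymbol a z₀ ξ) ∞ volume := by
    refine memLp_top_of_bound (C := A * Real.exp (|z₀.re| * A)) ?_ (.of_forall fun ξ => ?_)
    · have := measurable_expSymbol ha z₀
      exact Measurable.aestronglyMeasurable (by fun_prop)
    · rw [norm_mul, Complex.norm_real]
      gcongr
      · exact hA ξ
      · exact norm_expSymbol_le hA z₀ ξ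
  rw [hasDerivAt_iff_isLittleO]
  have hO : (fun z => mulOp (expSymbol a z) - mulOp (expSymbol a z₀) -
      (z - z₀) • mulOp (fun ξ => a ξ * expSymbol a z₀ ξ)) =O[𝓝 z₀] fun z => ‖z - z₀‖ ^ 2 := by
    refine Asymptotics.IsBigO.of_bound (Real.exp (|z₀.re| * A) * A ^ 2) ?_
    have hev : ∀ᶠ z in 𝓝 z₀, ‖z - z₀‖ * A < 1 := by
      have hc : Continuous fun z : ℂ => ‖z - z₀‖ * A := by fun_prop
      exact hc.continuousAt.eventually_lt continuousAt_const (by simp)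
    filter_upwards [hev] with z hz
    refine ContinuousLinearMap.opNorm_le_bound _ (by positivity) fun g => ?_
    refine Lp.norm_le_mul_norm_of_ae_le_mul ?_
    simp only [sub_apply, smul_apply]
    filter_upwards [coeFn_mulOp (memLp_expSymbol ha hA z) g,
      coeFn_mulOp (memLp_expSymbol ha hA z₀) g, coeFn_mulOp hD g,
      Lp.coeFn_sub (mulOp (expSymbol a z) g - mulOp (expSymbol a z₀) g)
        ((z - z₀) • mulOp (fun ξ => a ξ * expSymbol a z₀ ξ) g),
      Lp.coeFn_sub (mulOp (expSymbol a z) g) (mulOp (expSymbol a z₀) g),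
      Lp.coeFn_smul (z - z₀) (mulOp (fun ξ => a ξ * expSymbol a z₀ ξ) g)]
      with ξ h₁ h₂ h₃ h₄ h₅ h₆
    rw [h₄, Pi.sub_apply, h₅, Pi.sub_apply, h₆, Pi.smul_apply, h₁, h₂, h₃, smul_eq_mul]
    have hw : ‖(z - z₀) * a ξ‖ ≤ ‖z - z₀‖ * A := by
      rw [norm_mul, Complex.norm_real]
      gcongr
      exact hA ξ
    have hpt := norm_exp_sub_exp_sub_le (w := (z - z₀) * a ξ) (z := z₀ * a ξ) (hw.trans hz.le)
    have heq : expSymbol a z ξ * g ξ - expSymbol a z₀ ξ * g ξ -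
        (z - z₀) * (a ξ * expSymbol a z₀ ξ * g ξ) =
        (Complex.exp (z₀ * a ξ + (z - z₀) * a ξ) - Complex.exp (z₀ * a ξ) -
          (z - z₀) * a ξ * Complex.exp (z₀ * a ξ)) * g ξ := by
      simp only [expSymbol]
      rw [show z₀ * (a ξ : ℂ) + (z - z₀) * a ξ = z * a ξ by ring]
      ring
    rw [heq, norm_mul]
    gcongr
    refine hpt.trans ?_
    rw [norm_pow, norm_norm, mul_assoc, ← mul_pow, mul_comm A]
    gcongr
    exact norm_expSymbol_le hA z₀ ξ
  exact hO.trans_isLittleO (Asymptotics.isLittleO_pow_sub_sub z₀ one_lt_two)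

end expSymbol

/-! ### Powers of the Japanese bracket as multipliers -/

section bracket

variable {d : ℕ}

/-- The function `log ⟨ξ⟩`. -/
noncomputable def logBracket (ξ : Rd d) : ℝ := Real.log (japaneseBracket ξ)

theorem one_le_japaneseBracket (ξ : Rd d) : 1 ≤ japaneseBracket ξ := by
  rw [japaneseBracket, Real.one_le_sqrt]
  linarith [sq_nonneg ‖ξ‖]

theorem logBracket_nonneg (ξ : Rd d) : 0 ≤ logBracket ξ :=
  Real.log_nonneg (one_le_japaneseBracket ξ)

theorem continuous_logBracket : Continuous (logBracket : Rd d → ℝ) := by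
  have h : Continuous (japaneseBracket : Rd d → ℝ) := by
    unfold japaneseBracket
    fun_prop
  exact h.log fun ξ => (zero_lt_one.trans_le (one_le_japaneseBracket ξ)).ne'

theorem expSymbol_logBracket_ofReal (s : ℝ) (ξ : Rd d) :
    expSymbol logBracket (s : ℂ) ξ = ((japaneseBracket ξ ^ s : ℝ) : ℂ) := by
  rw [expSymbol, logBracket,
    Real.rpow_def_of_pos (zero_lt_one.trans_le (one_le_japaneseBracket ξ)), mul_comm]
  push_cast
  rfl

theorem expSymbol_add (a : Rd d → ℝ) (z w : ℂ) (ξ : Rd d) :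
    expSymbol a z ξ * expSymbol a w ξ = expSymbol a (z + w) ξ := by
  rw [expSymbol, expSymbol, expSymbol, ← Complex.exp_add, add_mul]

theorem norm_expSymbol_neg_le_one {z : ℂ} (hz : 0 ≤ z.re) (ξ : Rd d) :
    ‖expSymbol logBracket (-z) ξ‖ ≤ 1 := by
  rw [norm_expSymbol, Real.exp_le_one_iff, Complex.neg_re]
  nlinarith [mul_nonneg hz (logBracket_nonneg ξ)]

theorem memLp_expSymbol_neg {z : ℂ} (hz : 0 ≤ z.re) :
    MemLp (expSymbol logBracket (-z) : Rd d → ℂ) ∞ volume :=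
  memLp_top_of_bound
    (measurable_expSymbol continuous_logBracket.measurable _).aestronglyMeasurable 1
    (.of_forall (norm_expSymbol_neg_le_one hz))

/-- Multiplication by `⟨ξ⟩^{-z}` on `L²`, for `0 ≤ Re z`. -/
noncomputable def bracketOp (d : ℕ) (z : ℂ) : LTwo d →L[ℂ] LTwo d :=
  mulOp (expSymbol logBracket (-z))

theorem coeFn_bracketOp {z : ℂ} (hz : 0 ≤ z.re) (g : LTwo d) :
    bracketOp d z g =ᵐ[volume] fun ξ => expSymbol logBracket (-z) ξ * g ξ :=
  coeFn_mulOp (memLp_expSymbol_neg hz) g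

theorem norm_bracketOp_apply_le {z : ℂ} (hz : 0 ≤ z.re) (g : LTwo d) :
    ‖bracketOp d z g‖ ≤ ‖g‖ := by
  simpa only [one_mul, bracketOp] using
    norm_mulOp_apply_le (memLp_expSymbol_neg hz) (norm_expSymbol_neg_le_one hz) g

theorem bracketOp_bracketOp {z w : ℂ} (hz : 0 ≤ z.re) (hw : 0 ≤ w.re) (g : LTwo d) :
    bracketOp d z (bracketOp d w g) = bracketOp d (z + w) g :=
  mulOp_mulOp (memLp_expSymbol_neg hz) (memLp_expSymbol_neg hw)
    (memLp_expSymbol_neg (by rw [Complex.add_re]; positivity))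
    (fun ξ => by rw [expSymbol_add, neg_add]) g

theorem hasTemperateGrowth_expSymbol_neg (s : ℝ) :
    (expSymbol logBracket (-(s : ℂ)) : Rd d → ℂ).HasTemperateGrowth := by
  have h : (expSymbol logBracket (-(s : ℂ)) : Rd d → ℂ) =
      fun ξ => ((japaneseBracket ξ ^ (-s) : ℝ) : ℂ) := by
    funext ξ
    rw [← expSymbol_logBracket_ofReal, Complex.ofReal_neg]
  rw [h]
  exact hasTemperateGrowth_japaneseBracket_rpow d (-s)

/-- Both `⟨ξ⟩^s` and `⟨ξ⟩^{-s}` have temperate growth, so they act on tempered distributions as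
mutually inverse multipliers. This trades the unbounded weight for the bounded operator `bracketOp`.
-/
theorem weightedFourier_eq_lpEmb_iff {s : ℝ} (hs : 0 ≤ s) (u : 𝓢'(Rd d, ℂ)) (g : LTwo d) :
    weightedFourier d s u = lpEmb d 2 g ↔ 𝓕 u = lpEmb d 2 (bracketOp d s g) := by
  have htg := hasTemperateGrowth_expSymbol_neg (d := d) s
  have htp := hasTemperateGrowth_japaneseBracket_rpow d s
  have hone : (fun ξ : Rd d => ((japaneseBracket ξ ^ s : ℝ) : ℂ)) *
      expSymbol logBracket (-(s : ℂ)) = fun _ => 1 := by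
    funext ξ
    rw [Pi.mul_apply, ← expSymbol_logBracket_ofReal, expSymbol_add]
    simp [expSymbol]
  rw [bracketOp, lpEmb_mulOp (memLp_expSymbol_neg (by simpa using hs)) htg, weightedFourier]
  constructor
  · intro h
    rw [← h, TemperedDistribution.smulLeftCLM_smulLeftCLM_apply htp htg, hone]
    simp
  · intro h
    rw [h, TemperedDistribution.smulLeftCLM_smulLeftCLM_apply htg htp, mul_comm, hone]
    simp

/-! ### Truncated weights and their removal by Fatou's lemma. -/

theorem measurable_min_logBracket (n : ℕ) :
    Measurable fun ξ : Rd d => min (logBracket ξ) (n : ℝ) :=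
  continuous_logBracket.measurable.min measurable_const

theorem abs_min_logBracket_le (n : ℕ) (ξ : Rd d) : |min (logBracket ξ) (n : ℝ)| ≤ n := by
  rw [abs_of_nonneg (le_min (logBracket_nonneg ξ) n.cast_nonneg)]
  exact min_le_right _ _

theorem memLp_expSymbol_min (n : ℕ) (z : ℂ) :
    MemLp (expSymbol (fun ξ : Rd d => min (logBracket ξ) (n : ℝ)) z) ∞ volume :=
  memLp_expSymbol (measurable_min_logBracket n) (abs_min_logBracket_le n) z

/-- The candidate is `g = ⟨ξ⟩^s h`. At almost every `ξ` the truncated products are constant in `n`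
once `n ≥ log ⟨ξ⟩`, so Fatou's lemma gives both `g ∈ L²` and the bound. -/
theorem exists_bracketOp_eq_of_bound {s : ℝ} (hs : 0 ≤ s) (h : LTwo d) {K : ℝ} (hK : 0 ≤ K)
    (hb : ∀ n : ℕ, ‖mulOp (expSymbol (fun ξ => min (logBracket ξ) n) s) h‖ ≤ K) :
    ∃ g : LTwo d, h = bracketOp d s g ∧ ‖g‖ ≤ K := by
  have hlim : ∀ᵐ ξ : Rd d, Tendsto
      (fun n : ℕ => mulOp (expSymbol (fun ξ => min (logBracket ξ) n) s) h ξ) atTop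
      (𝓝 (expSymbol logBracket s ξ * h ξ)) := by
    filter_upwards [ae_all_iff.mpr fun n => coeFn_mulOp (memLp_expSymbol_min n s) h] with ξ hξ
    refine tendsto_const_nhds.congr' ?_
    filter_upwards [eventually_ge_atTop ⌈logBracket ξ⌉₊] with n hn
    rw [hξ, expSymbol, expSymbol, min_eq_left ((Nat.le_ceil _).trans (by exact_mod_cast hn))]
  have hle : eLpNorm (fun ξ => expSymbol logBracket s ξ * h ξ) 2 volume ≤ ENNReal.ofReal K := by
    refine (Lp.eLpNorm_lim_le_liminf_eLpNorm (fun n => Lp.aestronglyMeasurable _) _ hlim).trans ?_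
    refine liminf_le_of_le (by isBoundedDefault) fun b hb' => ?_
    obtain ⟨n, hn⟩ := hb'.exists
    refine hn.trans ?_
    rw [← ENNReal.ofReal_toReal (Lp.eLpNorm_ne_top _), ← Lp.norm_def]
    exact ENNReal.ofReal_le_ofReal (hb n)
  have hmem : MemLp (fun ξ => expSymbol logBracket s ξ * h ξ) 2 volume :=
    ⟨(measurable_expSymbol continuous_logBracket.measurable _).aestronglyMeasurable.mul
      (Lp.aestronglyMeasurable h), hle.trans_lt ENNReal.ofReal_lt_top⟩
  refine ⟨hmem.toLp, ?_, ?_⟩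
  · apply Lp.ext
    filter_upwards [coeFn_bracketOp (z := s) (by simpa using hs) hmem.toLp, hmem.coeFn_toLp]
      with ξ h₁ h₂
    rw [h₁, h₂, ← mul_assoc, expSymbol_add]
    simp [expSymbol]
  · rw [Lp.norm_toLp]
    exact ENNReal.toReal_le_of_le_ofReal hK hle

/-! ### Holomorphy of `z ↦ ⟨ξ⟩^{-z} g` for fixed `g ∈ L²`. -/

theorem exists_hasCompactSupport_approx (g : LTwo d) (n : ℕ) :
    ∃ (φ : LTwo d) (A : ℝ), ‖g - φ‖ ≤ 1 / (n + 1) ∧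
      ∀ᵐ ξ : Rd d, A < logBracket ξ → φ ξ = 0 := by
  obtain ⟨φ, hφ, hle, hc, hmem⟩ := (Lp.memLp g).exists_hasCompactSupport_eLpNorm_sub_le
    ENNReal.ofNat_ne_top (ε := ENNReal.ofReal (1 / (n + 1)))
    (by rw [ne_eq, ENNReal.ofReal_eq_zero, not_le]; positivity)
  obtain ⟨A, hA⟩ := hφ.isCompact.bddAbove_image (f := logBracket) continuous_logBracket.continuousOn
  refine ⟨hmem.toLp, A, ?_, ?_⟩
  · rw [Lp.norm_def]
    refine ENNReal.toReal_le_of_le_ofReal (by positivity) (le_of_eq_of_le ?_ hle)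
    apply eLpNorm_congr_ae
    filter_upwards [Lp.coeFn_sub g hmem.toLp, hmem.coeFn_toLp] with ξ h₁ h₂
    rw [h₁, Pi.sub_apply, Pi.sub_apply, h₂]
  · filter_upwards [hmem.coeFn_toLp] with ξ h hξ
    rw [h]
    by_contra hne
    exact hξ.not_ge (hA ⟨ξ, subset_tsupport φ hne, rfl⟩)

/-- Where `φ` does not vanish, `log ⟨ξ⟩` may be replaced by its truncation at `max A 0`, so the
orbit of `φ` agrees on the half-plane with an entire function. The maximum with `0` covers a
negative `A`. -/
theorem differentiableOn_bracketOp_apply_of_support {φ : LTwo d} {A : ℝ}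
    (hφ : ∀ᵐ ξ : Rd d, A < logBracket ξ → φ ξ = 0) :
    DifferentiableOn ℂ (fun z => bracketOp d z φ) {z | 0 ≤ z.re} := by
  have ha : Measurable fun ξ : Rd d => min (logBracket ξ) (max A 0) :=
    continuous_logBracket.measurable.min measurable_const
  have hA : ∀ ξ : Rd d, |min (logBracket ξ) (max A 0)| ≤ max A 0 := fun ξ => by
    rw [abs_of_nonneg (le_min (logBracket_nonneg ξ) (le_max_right _ _))]
    exact min_le_right _ _
  have hdiff : Differentiable ℂ fun z : ℂ =>
      mulOp (expSymbol (fun ξ : Rd d => min (logBracket ξ) (max A 0)) (-z)) φ := by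
    intro z
    have h := (hasDerivAt_mulOp_expSymbol ha hA (-z)).differentiableAt.comp z
      (differentiableAt_id.neg)
    exact h.clm_apply (differentiableAt_const φ)
  refine hdiff.differentiableOn.congr fun z hz => ?_
  apply Lp.ext
  filter_upwards [coeFn_bracketOp hz φ, coeFn_mulOp (memLp_expSymbol ha hA (-z)) φ, hφ]
    with ξ h₁ h₂ h₃
  rw [h₁, h₂]
  by_cases hξ : A < logBracket ξ
  · rw [h₃ hξ, mul_zero, mul_zero]
  · rw [expSymbol, expSymbol, min_eq_left ((not_lt.mp hξ).trans (le_max_left _ _))]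

/-- The operators `bracketOp d z` are contractions for `0 ≤ Re z`, so the orbits of the compactly
supported approximants converge uniformly there; continuity and holomorphy pass to the limit. -/
theorem bracketOp_apply_regularity (g : LTwo d) :
    ContinuousOn (fun z => bracketOp d z g) {z | 0 ≤ z.re} ∧
      DifferentiableOn ℂ (fun z => bracketOp d z g) {z | 0 < z.re} := by
  choose φ A hφ hsupp using exists_hasCompactSupport_approx g
  have hunif : TendstoUniformlyOn (fun n z => bracketOp d z (φ n)) (fun z => bracketOp d z g)
      atTop {z | 0 ≤ z.re} := by
    rw [Metric.tendstoUniformlyOn_iff]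
    intro ε hε
    filter_upwards [(tendsto_one_div_add_atTop_nhds_zero_nat (𝕜 := ℝ)).eventually_lt_const hε]
      with n hn z hz
    rw [dist_eq_norm, ← map_sub]
    exact ((norm_bracketOp_apply_le hz _).trans (hφ n)).trans_lt hn
  have hsub : {z : ℂ | 0 < z.re} ⊆ {z | 0 ≤ z.re} := fun _ hz => le_of_lt (Set.mem_ofPred_eq ▸ hz)
  constructor
  · exact hunif.continuousOn (.of_forall fun n =>
      (differentiableOn_bracketOp_apply_of_support (hsupp n)).continuousOn)
  · exact (hunif.mono hsub).tendstoLocallyUniformlyOn.differentiableOn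
      (.of_forall fun n => (differentiableOn_bracketOp_apply_of_support (hsupp n)).mono hsub)
      (isOpen_lt continuous_const Complex.continuous_re)

end bracket

/-! ### Sobolev spaces of integer order on the Fourier side -/

section derivSymbol

variable {d : ℕ}

/-- The symbol `2πi ξ_i` of `∂_i`. -/
noncomputable def partialSymbol (i : Fin d) (ξ : Rd d) : ℂ :=
  2 * Real.pi * Complex.I * ((ξ i : ℝ) : ℂ)

/-- The symbol `(2πi ξ)^α` of `D^α`. -/
noncomputable def derivSymbol (α : Fin d → ℕ) : Rd d → ℂ :=
  (List.ofFn fun i => partialSymbol i ^ α i).prod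

theorem derivSymbol_apply (α : Fin d → ℕ) (ξ : Rd d) :
    derivSymbol α ξ = ∏ i, partialSymbol i ξ ^ α i := by
  rw [derivSymbol, List.prod_ofFn, Finset.prod_apply]
  rfl

theorem partialSymbol_eq (i : Fin d) : (partialSymbol i : Rd d → ℂ) =
    (2 * Real.pi * Complex.I : ℂ) •
      fun ξ : Rd d => ((inner ℝ ξ (EuclideanSpace.single i (1 : ℝ)) : ℝ) : ℂ) := by
  funext ξ
  simp [partialSymbol, EuclideanSpace.inner_single_right]

theorem hasTemperateGrowth_inner_single (i : Fin d) : (fun ξ : Rd d =>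
    ((inner ℝ ξ (EuclideanSpace.single i (1 : ℝ)) : ℝ) : ℂ)).HasTemperateGrowth := by
  fun_prop

theorem hasTemperateGrowth_partialSymbol (i : Fin d) :
    (partialSymbol i : Rd d → ℂ).HasTemperateGrowth := by
  rw [partialSymbol_eq]
  exact (Function.HasTemperateGrowth.const _).mul (hasTemperateGrowth_inner_single i)

theorem fourier_lineDeriv_eq (i : Fin d) (u : 𝓢'(Rd d, ℂ)) :
    𝓕 (LineDeriv.lineDerivOpCLM ℂ 𝓢'(Rd d, ℂ) (EuclideanSpace.single i (1 : ℝ)) u) =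
      TemperedDistribution.smulLeftCLM ℂ (partialSymbol i) (𝓕 u) := by
  rw [partialSymbol_eq, TemperedDistribution.smulLeftCLM_smul (hasTemperateGrowth_inner_single i)]
  exact TemperedDistribution.fourier_lineDerivOp_eq u _

/-- `D` is the Fourier multiplier with symbol `σ`. -/
def HasFourierSymbol (D : 𝓢'(Rd d, ℂ) →L[ℂ] 𝓢'(Rd d, ℂ)) (σ : Rd d → ℂ) : Prop :=
  σ.HasTemperateGrowth ∧ ∀ u, 𝓕 (D u) = TemperedDistribution.smulLeftCLM ℂ σ (𝓕 u)

theorem hasFourierSymbol_one : HasFourierSymbol (1 : 𝓢'(Rd d, ℂ) →L[ℂ] 𝓢'(Rd d, ℂ)) 1 :=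
  ⟨Function.HasTemperateGrowth.const 1, fun u => by
    have := TemperedDistribution.smulLeftCLM_const (E := Rd d) (1 : ℂ) (𝓕 u)
    rw [one_smul] at this
    exact this.symm⟩

theorem HasFourierSymbol.mul {D E : 𝓢'(Rd d, ℂ) →L[ℂ] 𝓢'(Rd d, ℂ)} {σ τ : Rd d → ℂ}
    (hD : HasFourierSymbol D σ) (hE : HasFourierSymbol E τ) :
    HasFourierSymbol (D * E) (σ * τ) :=
  ⟨hD.1.mul hE.1, fun u => by
    change 𝓕 (D (E u)) = _
    rw [hD.2, hE.2,
      TemperedDistribution.smulLeftCLM_smulLeftCLM_apply hE.1 hD.1, mul_comm]⟩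

theorem HasFourierSymbol.pow {D : 𝓢'(Rd d, ℂ) →L[ℂ] 𝓢'(Rd d, ℂ)} {σ : Rd d → ℂ}
    (hD : HasFourierSymbol D σ) (n : ℕ) : HasFourierSymbol (D ^ n) (σ ^ n) := by
  induction n with
  | zero => simpa only [pow_zero] using hasFourierSymbol_one
  | succ n ih => simpa only [pow_succ] using ih.mul hD

theorem hasFourierSymbol_list_prod {ι : Type*} {D : ι → 𝓢'(Rd d, ℂ) →L[ℂ] 𝓢'(Rd d, ℂ)}
    {σ : ι → Rd d → ℂ} (h : ∀ i, HasFourierSymbol (D i) (σ i)) (l : List ι) :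
    HasFourierSymbol (l.map D).prod (l.map σ).prod := by
  induction l with
  | nil => exact hasFourierSymbol_one
  | cons i l ih => simpa only [List.map_cons, List.prod_cons] using (h i).mul ih

theorem hasFourierSymbol_weakDeriv (α : Fin d → ℕ) :
    HasFourierSymbol (weakDeriv α) (derivSymbol α) := by
  rw [weakDeriv, derivSymbol, List.ofFn_eq_map, List.ofFn_eq_map]
  exact hasFourierSymbol_list_prod (fun i => HasFourierSymbol.pow
    ⟨hasTemperateGrowth_partialSymbol i, fourier_lineDeriv_eq i⟩ (α i)) _

theorem norm_partialSymbol (i : Fin d) (ξ : Rd d) :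
    ‖partialSymbol i ξ‖ = 2 * Real.pi * |ξ i| := by
  simp [partialSymbol, abs_of_pos Real.pi_pos]

theorem japaneseBracket_sq (ξ : Rd d) : japaneseBracket ξ ^ 2 = 1 + ∑ i, ξ i ^ 2 := by
  rw [japaneseBracket, Real.sq_sqrt (by positivity), EuclideanSpace.real_norm_sq_eq]

theorem abs_apply_le_japaneseBracket (ξ : Rd d) (i : Fin d) : |ξ i| ≤ japaneseBracket ξ := by
  refine abs_le_of_sq_le_sq ?_ (zero_le_one.trans (one_le_japaneseBracket ξ))
  rw [japaneseBracket_sq]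
  have := Finset.single_le_sum (f := fun i => ξ i ^ 2) (fun i _ => sq_nonneg _) (Finset.mem_univ i)
  linarith

theorem norm_derivSymbol_le {k : ℕ} {α : Fin d → ℕ} (hα : ∑ i, α i ≤ k) (ξ : Rd d) :
    ‖derivSymbol α ξ‖ ≤ (2 * Real.pi) ^ k * japaneseBracket ξ ^ k := by
  have h1 := one_le_japaneseBracket ξ
  have hpi : 1 ≤ 2 * Real.pi := by linarith [Real.pi_gt_three]
  rw [derivSymbol_apply, norm_prod, ← mul_pow]
  calc ∏ i, ‖partialSymbol i ξ ^ α i‖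
      ≤ ∏ i, (2 * Real.pi * japaneseBracket ξ) ^ α i := by
        refine Finset.prod_le_prod (fun i _ => norm_nonneg _) fun i _ => ?_
        rw [norm_pow, norm_partialSymbol]
        gcongr
        exact abs_apply_le_japaneseBracket ξ i
    _ = (2 * Real.pi * japaneseBracket ξ) ^ ∑ i, α i := Finset.prod_pow_eq_pow_sum _ _ _
    _ ≤ _ := pow_le_pow_right₀ (one_le_mul_of_one_le_of_one_le hpi h1) hα

/-- Pigeonhole: `⟨ξ⟩² = 1 + ∑ ξ_i²` has `d + 1` terms, so one of them is at least `⟨ξ⟩² / (d + 1)`.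
If it is `ξ_i²`, the pure derivative `∂_i^k` controls `⟨ξ⟩^k`; if it is `1`, the index `α = 0` does.
-/
theorem japaneseBracket_pow_le_sum (k : ℕ) (ξ : Rd d) :
    japaneseBracket ξ ^ k ≤
      (d + 1 : ℝ) ^ k * ∑ α : MultiIndex d k, ‖derivSymbol (fun i => (α.1 i : ℕ)) ξ‖ := by
  have hb := one_le_japaneseBracket ξ
  have hd : (1 : ℝ) ≤ d + 1 := by linarith [(Nat.cast_nonneg d : (0 : ℝ) ≤ d)]
  have key : ∀ α : MultiIndex d k, ∀ x : ℝ, 0 ≤ x →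
      x ^ k ≤ ‖derivSymbol (fun i => (α.1 i : ℕ)) ξ‖ →
      japaneseBracket ξ ^ 2 ≤ ((d + 1 : ℝ) * x ^ 2) →
      japaneseBracket ξ ^ k ≤
        (d + 1 : ℝ) ^ k * ∑ α : MultiIndex d k, ‖derivSymbol (fun i => (α.1 i : ℕ)) ξ‖ := by
    intro α x hx0 hx hxb
    have h1 : japaneseBracket ξ ≤ (d + 1) * x := by
      refine (abs_le_of_sq_le_sq' ?_ (by positivity)).2
      rw [mul_pow]
      refine hxb.trans ?_
      gcongr
      -- The natural constant `√(d + 1)` is weakened to `d + 1` to avoid square roots.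
      exact le_self_pow₀ hd two_ne_zero
    calc japaneseBracket ξ ^ k ≤ ((d + 1) * x) ^ k := by gcongr
      _ = (d + 1 : ℝ) ^ k * x ^ k := mul_pow _ _ _
      _ ≤ _ := by
        gcongr
        exact hx.trans (Finset.single_le_sum
          (f := fun α : MultiIndex d k => ‖derivSymbol (fun i => (α.1 i : ℕ)) ξ‖)
          (fun _ _ => norm_nonneg _) (Finset.mem_univ α))
  by_cases h : ∃ i, japaneseBracket ξ ^ 2 ≤ (d + 1) * ξ i ^ 2
  · obtain ⟨i, hi⟩ := h
    have hsum : ∑ j, ((Pi.single i (Fin.last k) : Fin d → Fin (k + 1)) j : ℕ) ≤ k := by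
      rw [Finset.sum_eq_single i]
      · simp
      · intro j _ hj
        simp [Pi.single_eq_of_ne hj]
      · simp
    refine key ⟨Pi.single i (Fin.last k), hsum⟩ |ξ i| (abs_nonneg _) ?_ (by rwa [sq_abs])
    rw [derivSymbol_apply, Finset.prod_eq_single i]
    · rw [norm_pow, norm_partialSymbol]
      simp only [Pi.single_eq_same, Fin.val_last]
      gcongr
      exact le_mul_of_one_le_left (abs_nonneg _) (by linarith [Real.pi_gt_three])
    · intro j _ hj
      simp [Pi.single_eq_of_ne hj]
    · simp
  · push Not at h
    -- Summing `(d + 1) ξ_i² < ⟨ξ⟩²` over `i` yields `(d + 1)(⟨ξ⟩² - 1) ≤ d ⟨ξ⟩²`, that is, `⟨ξ⟩² ≤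
    -- d + 1`.
    refine key (SobolevSpace.zeroIndex d k) 1 zero_le_one ?_ ?_
    · simp [derivSymbol_apply, SobolevSpace.zeroIndex]
    · have hs : ∑ i, (d + 1) * ξ i ^ 2 ≤ ∑ _i : Fin d, japaneseBracket ξ ^ 2 :=
        Finset.sum_le_sum fun i _ => (h i).le
      rw [← Finset.mul_sum, Finset.sum_const, Finset.card_univ, Fintype.card_fin, nsmul_eq_mul] at hs
      have := japaneseBracket_sq ξ
      nlinarith

/-- The symbol `(2πi ξ)^α ⟨ξ⟩^{-k}`. -/
noncomputable def normalizedSymbol (k : ℕ) (α : Fin d → ℕ) : Rd d → ℂ :=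
  expSymbol logBracket (-((k : ℝ) : ℂ)) * derivSymbol α

theorem norm_expSymbol_neg_natCast (k : ℕ) (ξ : Rd d) :
    ‖expSymbol logBracket (-((k : ℝ) : ℂ)) ξ‖ = (japaneseBracket ξ ^ k)⁻¹ := by
  have hpos : 0 ≤ japaneseBracket ξ := zero_le_one.trans (one_le_japaneseBracket ξ)
  rw [← Complex.ofReal_neg, expSymbol_logBracket_ofReal, Complex.norm_real, Real.norm_eq_abs,
    abs_of_nonneg (Real.rpow_nonneg hpos _), Real.rpow_neg hpos, Real.rpow_natCast]

theorem hasTemperateGrowth_normalizedSymbol (k : ℕ) (α : Fin d → ℕ) :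
    (normalizedSymbol k α).HasTemperateGrowth :=
  (hasTemperateGrowth_expSymbol_neg _).mul (hasFourierSymbol_weakDeriv α).1

theorem memLp_normalizedSymbol {k : ℕ} {α : Fin d → ℕ} (hα : ∑ i, α i ≤ k) :
    MemLp (normalizedSymbol k α) ∞ volume := by
  refine memLp_top_of_bound (C := (2 * Real.pi) ^ k)
    (hasTemperateGrowth_normalizedSymbol k α).1.continuous.aestronglyMeasurable
    (.of_forall fun ξ => ?_)
  have hpos := pow_pos (zero_lt_one.trans_le (one_le_japaneseBracket ξ)) k
  rw [normalizedSymbol, Pi.mul_apply, norm_mul, norm_expSymbol_neg_natCast,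
    inv_mul_le_iff₀ hpos, mul_comm]
  exact norm_derivSymbol_le hα ξ

theorem lpEmb_bracketOp {s : ℝ} (hs : 0 ≤ s) (g : LTwo d) :
    lpEmb d 2 (bracketOp d s g) =
      TemperedDistribution.smulLeftCLM ℂ (expSymbol logBracket (-(s : ℂ))) (lpEmb d 2 g) :=
  lpEmb_mulOp (memLp_expSymbol_neg (by simpa using hs)) (hasTemperateGrowth_expSymbol_neg s) g

/-- The possibly unbounded symbol `(2πiξ)^α` is absorbed by `⟨ξ⟩^{-k}` into one bounded multiplier,
which brings the computation back into `L²`. -/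
theorem smulLeftCLM_derivSymbol_lpEmb_bracketOp {k : ℕ} {α : Fin d → ℕ} (hα : ∑ i, α i ≤ k)
    (g : LTwo d) :
    TemperedDistribution.smulLeftCLM ℂ (derivSymbol α) (lpEmb d 2 (bracketOp d (k : ℝ) g)) =
      lpEmb d 2 (mulOp (normalizedSymbol k α) g) := by
  rw [lpEmb_bracketOp k.cast_nonneg, TemperedDistribution.smulLeftCLM_smulLeftCLM_apply
    (hasTemperateGrowth_expSymbol_neg _) (hasFourierSymbol_weakDeriv α).1,
    lpEmb_mulOp (memLp_normalizedSymbol hα) (hasTemperateGrowth_normalizedSymbol k α)]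
  rfl

theorem fourier_injective : Function.Injective (fun u : 𝓢'(Rd d, ℂ) => 𝓕 u) := by
  intro u v h
  have := congrArg (fun w => 𝓕⁻ w) h
  simpa using this

theorem fourier_lpEmb (g : LTwo d) : 𝓕 (lpEmb d 2 g) = lpEmb d 2 (𝓕 g) :=
  Lp.fourier_toTemperedDistribution_eq g

theorem fourier_lpEmb_fourierInv (g : LTwo d) : 𝓕 (lpEmb d 2 (𝓕⁻ g)) = lpEmb d 2 g := by
  rw [fourier_lpEmb, FourierTransform.fourier_fourierInv_eq]

end derivSymbol

/-! ### `W^{k,2}` as the inverse Fourier image of `⟨ξ⟩^{-k} L²`. -/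

section sobolevFourier

variable {d : ℕ}

theorem weakDeriv_lpEmb_fourierInv (k : ℕ) (g : LTwo d) (α : MultiIndex d k) :
    weakDeriv (fun i => (α.1 i : ℕ)) (lpEmb d 2 (𝓕⁻ (bracketOp d (k : ℝ) g))) =
      lpEmb d 2 (𝓕⁻ (mulOp (normalizedSymbol k fun i => (α.1 i : ℕ)) g)) := by
  apply fourier_injective
  simp only
  rw [(hasFourierSymbol_weakDeriv _).2, fourier_lpEmb_fourierInv, fourier_lpEmb_fourierInv,
    smulLeftCLM_derivSymbol_lpEmb_bracketOp α.2]

/-- The element of `W^{k,2}` with Fourier transform `⟨ξ⟩^{-k} g`. -/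
noncomputable def sobolevLift (d k : ℕ) (g : LTwo d) : SobolevSpace d k 2 :=
  ⟨lpEmb d 2 (𝓕⁻ (bracketOp d (k : ℝ) g)), fun α => ⟨_, weakDeriv_lpEmb_fourierInv k g α⟩⟩

theorem fourier_incl_sobolevLift (k : ℕ) (g : LTwo d) :
    𝓕 (SobolevSpace.incl d k 2 (sobolevLift d k g)) = lpEmb d 2 (bracketOp d (k : ℝ) g) :=
  fourier_lpEmb_fourierInv _

theorem fourier_incl_injective (k : ℕ) :
    Function.Injective (fun u => 𝓕 (SobolevSpace.incl d k 2 u)) :=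
  fourier_injective.comp SobolevSpace.incl_injective

/-- The jet of the lift is the image of `g` under a bounded operator `J`, with components `𝓕⁻¹`
after multiplication by `(2πiξ)^α ⟨ξ⟩^{-k}`; the norm of `J` is the constant. -/
theorem norm_sobolevLift_le (k : ℕ) : ∃ C : ℝ, 0 ≤ C ∧ ∀ g, ‖sobolevLift d k g‖ ≤ C * ‖g‖ := by
  let J : LTwo d →L[ℂ] PiLp 2 (fun _ : MultiIndex d k => LTwo d) :=
    ((PiLp.continuousLinearEquiv 2 ℂ (fun _ : MultiIndex d k => LTwo d)).symm :
      (MultiIndex d k → LTwo d) →L[ℂ] _).comp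
    (ContinuousLinearMap.pi fun α =>
      ((Lp.fourierTransformₗᵢ (Rd d) ℂ).symm.toContinuousLinearEquiv :
        LTwo d →L[ℂ] LTwo d).comp (mulOp (normalizedSymbol k fun i => (α.1 i : ℕ))))
  refine ⟨‖J‖, norm_nonneg _, fun g => ?_⟩
  have h : SobolevSpace.jet d k 2 (sobolevLift d k g) = J g := by
    ext1 α
    apply lpEmb_injective d 2
    exact (SobolevSpace.lpEmb_derivLp _ α).trans (weakDeriv_lpEmb_fourierInv k g α)
  change ‖SobolevSpace.jet d k 2 (sobolevLift d k g)‖ ≤ _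
  rw [h]
  exact J.le_opNorm g

/-- The map `sobolevLift` as a continuous linear map. -/
noncomputable def sobolevLiftCLM (d k : ℕ) : LTwo d →L[ℂ] SobolevSpace d k 2 :=
  LinearMap.mkContinuousOfExistsBound
    { toFun := sobolevLift d k
      map_add' := fun g h => by
        apply fourier_incl_injective
        simp only [map_add, fourier_incl_sobolevLift, FourierTransform.fourier_add]
      map_smul' := fun c g => by
        apply fourier_incl_injective
        simp only [map_smul, fourier_incl_sobolevLift, FourierTransform.fourier_smul,
          RingHom.id_apply] }
    ((norm_sobolevLift_le k).imp fun _ h => h.2)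

theorem fourier_incl_sobolevLiftCLM (k : ℕ) (g : LTwo d) :
    𝓕 (SobolevSpace.incl d k 2 (sobolevLiftCLM d k g)) = lpEmb d 2 (bracketOp d (k : ℝ) g) :=
  fourier_incl_sobolevLift k g

/-- The product `(2πiξ)^α h` is not known beforehand to lie in `L²`. Both sides are therefore damped
by `⟨ξ⟩^{-k}`, compared as `L²` functions, and the nonvanishing factor is cancelled pointwise. -/
theorem fourier_derivLp_ae_eq {k : ℕ} (u : SobolevSpace d k 2) {h : LTwo d}
    (hu : 𝓕 (SobolevSpace.incl d k 2 u) = lpEmb d 2 h) (α : MultiIndex d k) :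
    (𝓕 (u.derivLp α) : LTwo d) =ᵐ[volume]
      fun ξ => derivSymbol (fun i => (α.1 i : ℕ)) ξ * h ξ := by
  have hk : 0 ≤ ((k : ℝ) : ℂ).re := by simp
  have heq : bracketOp d (k : ℝ) (𝓕 (u.derivLp α)) =
      mulOp (normalizedSymbol k fun i => (α.1 i : ℕ)) h := by
    apply lpEmb_injective d 2
    rw [← smulLeftCLM_derivSymbol_lpEmb_bracketOp α.2, lpEmb_bracketOp k.cast_nonneg,
      lpEmb_bracketOp k.cast_nonneg, ← fourier_lpEmb, SobolevSpace.lpEmb_derivLp,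
      (hasFourierSymbol_weakDeriv _).2, hu,
      TemperedDistribution.smulLeftCLM_smulLeftCLM_apply
        (hasFourierSymbol_weakDeriv _).1 (hasTemperateGrowth_expSymbol_neg _),
      TemperedDistribution.smulLeftCLM_smulLeftCLM_apply
        (hasTemperateGrowth_expSymbol_neg _) (hasFourierSymbol_weakDeriv _).1, mul_comm]
  filter_upwards [coeFn_bracketOp hk (𝓕 (u.derivLp α) : LTwo d),
    coeFn_mulOp (memLp_normalizedSymbol α.2) h] with ξ h₁ h₂
  rw [heq, h₂, normalizedSymbol, Pi.mul_apply, mul_assoc] at h₁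
  exact (mul_left_cancel₀ (Complex.exp_ne_zero _) h₁).symm

/-- Pointwise, `⟨ξ⟩^k |û|` is at most `(d + 1)^k` times `G = ∑_α |𝓕(D^α u)|`, whose `L²` norm is
controlled by Plancherel. The truncated weights inherit this bound uniformly in `n`. -/
theorem exists_fourier_incl_eq_bracketOp (d k : ℕ) : ∃ C : ℝ, 0 < C ∧
    ∀ u : SobolevSpace d k 2, ∃ g : LTwo d,
      𝓕 (SobolevSpace.incl d k 2 u) = lpEmb d 2 (bracketOp d (k : ℝ) g) ∧ ‖g‖ ≤ C * ‖u‖ := by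
  refine ⟨(d + 1 : ℝ) ^ k * (Fintype.card (MultiIndex d k) + 1), by positivity, fun u => ?_⟩
  have hnorm : ∀ α, ‖(𝓕 (u.derivLp α) : LTwo d)‖ ≤ ‖u‖ := fun α => by
    rw [Lp.norm_fourier_eq]
    exact PiLp.norm_apply_le (SobolevSpace.jet d k 2 u) α
  let h : LTwo d := 𝓕 (u.derivLp (SobolevSpace.zeroIndex d k))
  have hu : 𝓕 (SobolevSpace.incl d k 2 u) = lpEmb d 2 h := by
    rw [← fourier_lpEmb, SobolevSpace.lpEmb_derivLp, SobolevSpace.weakDeriv_zeroIndex]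
  have hmem : ∀ α, MemLp (fun ξ => ‖(𝓕 (u.derivLp α) : LTwo d) ξ‖) 2 volume :=
    fun α => (Lp.memLp _).norm
  let G : Lp ℝ 2 (volume : Measure (Rd d)) := ∑ α, (hmem α).toLp
  have hG : ‖G‖ ≤ Fintype.card (MultiIndex d k) * ‖u‖ := by
    refine (norm_sum_le _ _).trans ?_
    rw [← nsmul_eq_mul, ← Finset.card_univ]
    refine Finset.sum_le_card_nsmul _ _ _ fun α _ => ?_
    rw [Lp.norm_toLp, eLpNorm_norm, ← Lp.norm_def]
    exact hnorm α
  have hb : ∀ n : ℕ, ‖mulOp (expSymbol (fun ξ => min (logBracket ξ) n) (k : ℝ)) h‖ ≤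
      (d + 1 : ℝ) ^ k * ‖G‖ := by
    intro n
    refine Lp.norm_le_mul_norm_of_ae_le_mul ?_
    filter_upwards [coeFn_mulOp (memLp_expSymbol_min n (k : ℝ)) h, ae_all_iff.mpr fun α => (hmem α).coeFn_toLp,
      ae_all_iff.mpr (fourier_derivLp_ae_eq u hu),
      Lp.coeFn_finsetSum Finset.univ fun α => (hmem α).toLp] with ξ h₁ h₂ h₃ h₄
    have hGξ : G ξ = ∑ α : MultiIndex d k,
        ‖derivSymbol (fun i => (α.1 i : ℕ)) ξ‖ * ‖h ξ‖ := by
      rw [h₄, Finset.sum_apply]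
      exact Finset.sum_congr rfl fun α _ => by rw [h₂, h₃, norm_mul]
    rw [h₁, norm_mul, hGξ, ← Finset.sum_mul, Real.norm_of_nonneg (by positivity), ← mul_assoc]
    gcongr
    refine le_trans ?_ (japaneseBracket_pow_le_sum k ξ)
    have hpos := zero_lt_one.trans_le (one_le_japaneseBracket ξ)
    rw [norm_expSymbol, Complex.ofReal_re, ← Real.rpow_natCast, Real.rpow_def_of_pos hpos,
      mul_comm (Real.log _)]
    gcongr
    exact min_le_left _ _
  obtain ⟨g, hg, hgn⟩ := exists_bracketOp_eq_of_bound k.cast_nonneg h (by positivity) hb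
  refine ⟨g, by rw [hu, hg], hgn.trans ?_⟩
  rw [mul_assoc]
  gcongr
  refine hG.trans ?_
  gcongr
  linarith

end sobolevFourier

/-! ### Weakly holomorphic functions -/

/-- Continuity makes the Cauchy integral of `f` over a small circle meaningful, and that integral is
analytic. Functionals commute with it, so the scalar Cauchy formula identifies it with `f`,
functionals being separating. Strip functions are only weakly holomorphic, whereas the three lines
theorem is applied to a norm-holomorphic function. -/
theorem differentiableOn_of_forall_dual {E : Type*} [NormedAddCommGroup E] [NormedSpace ℂ E]
    [CompleteSpace E] {U : Set ℂ} (hU : IsOpen U) {f : ℂ → E} (hc : ContinuousOn f U)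
    (hf : ∀ l : E →L[ℂ] ℂ, DifferentiableOn ℂ (fun z => l (f z)) U) :
    DifferentiableOn ℂ f U := by
  intro z hz
  obtain ⟨R, hR, hball⟩ := Metric.nhds_basis_closedBall.mem_iff.mp (hU.mem_nhds hz)
  lift R to NNReal using hR.le
  have hR' : 0 < R := by exact_mod_cast hR
  have hci : CircleIntegrable f z R :=
    (hc.mono (Metric.sphere_subset_closedBall.trans hball)).circleIntegrable R.coe_nonneg
  have hps := hasFPowerSeriesOn_cauchy_integral hci hR'
  have heq : ∀ w ∈ Metric.ball z R,
      (2 * Real.pi * Complex.I : ℂ)⁻¹ • ∮ ζ in C(z, R), (ζ - w)⁻¹ • f ζ = f w := by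
    intro w hw
    refine eq_of_sub_eq_zero (SeparatingDual.eq_zero_of_forall_dual_eq_zero (R := ℂ) fun l => ?_)
    have hcw : CircleIntegrable (fun ζ => (ζ - w)⁻¹ • f ζ) z R := by
      refine ContinuousOn.circleIntegrable R.coe_nonneg (ContinuousOn.smul ?_
        (hc.mono (Metric.sphere_subset_closedBall.trans hball)))
      refine ContinuousOn.inv₀ (by fun_prop) fun ζ hζ h => ?_
      rw [sub_eq_zero] at h
      rw [h, Metric.mem_sphere] at hζ
      exact hw.ne hζ
    have hint : l (∮ ζ in C(z, R), (ζ - w)⁻¹ • f ζ) = ∮ ζ in C(z, R), (ζ - w)⁻¹ • l (f ζ) := by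
      simp only [circleIntegral]
      rw [← ContinuousLinearMap.intervalIntegral_comp_comm l hcw.out]
      simp only [map_smul]
    have hC := DiffContOnCl.circleIntegral_sub_inv_smul (f := fun ζ => l (f ζ)) (c := z) (R := R)
      (w := w) (DifferentiableOn.diffContOnCl
        ((hf l).mono (Metric.closure_ball_subset_closedBall.trans hball))) hw
    rw [map_sub, map_smul, hint, hC, inv_smul_smul₀ Complex.two_pi_I_ne_zero, sub_self]
  have hda := (hps.differentiableOn.differentiableAt
    (Metric.isOpen_eball.mem_nhds (Metric.mem_eball_self (by exact_mod_cast hR'))))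
  refine (hda.congr_of_eventuallyEq ?_).differentiableWithinAt
  filter_upwards [Metric.ball_mem_nhds z hR] with w hw
  exact (heq w hw).symm

/-! ### The Fourier transform on the sum space -/

section sumFourier

variable {d : ℕ}

/-- The Fourier transform `W^{k,2} → L²`. -/
noncomputable def sobolevFourier (d k : ℕ) : SobolevSpace d k 2 →L[ℂ] LTwo d :=
  LinearMap.mkContinuous
    { toFun := fun u => 𝓕 (SobolevSpace.jet d k 2 u (SobolevSpace.zeroIndex d k))
      map_add' := fun u v => by
        rw [map_add, PiLp.add_apply, FourierTransform.fourier_add]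
      map_smul' := fun c u => by
        rw [map_smul, PiLp.smul_apply, FourierTransform.fourier_smul, RingHom.id_apply] } 1
    fun u => by
      rw [one_mul]
      exact (Lp.norm_fourier_eq _).le.trans (PiLp.norm_apply_le (SobolevSpace.jet d k 2 u) _)

theorem lpEmb_sobolevFourier (k : ℕ) (u : SobolevSpace d k 2) :
    lpEmb d 2 (sobolevFourier d k u) = 𝓕 (SobolevSpace.incl d k 2 u) := by
  rw [← SobolevSpace.lpEmb_jet_zero, fourier_lpEmb]
  rfl

/-- The Fourier transform on pairs, `(u, v) ↦ 𝓕 (u + v)`. -/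
noncomputable def pairFourier (d k : ℕ) :
    WithLp 1 (SobolevSpace d k 2 × SobolevSpace d (k + 1) 2) →L[ℂ] LTwo d :=
  ((sobolevFourier d k).coprod (sobolevFourier d (k + 1))).comp
    (WithLp.prodContinuousLinearEquiv 1 ℂ (SobolevSpace d k 2) (SobolevSpace d (k + 1) 2) :
      WithLp 1 (SobolevSpace d k 2 × SobolevSpace d (k + 1) 2) →L[ℂ] _)

theorem lpEmb_pairFourier (k : ℕ) (x : WithLp 1 (SobolevSpace d k 2 × SobolevSpace d (k + 1) 2)) :
    lpEmb d 2 (pairFourier d k x) = 𝓕 ((sobolevCouple d k 2).addMap x) := by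
  have h : pairFourier d k x = sobolevFourier d k x.fst + sobolevFourier d (k + 1) x.snd := rfl
  rw [h, map_add, lpEmb_sobolevFourier, lpEmb_sobolevFourier, ← FourierTransform.fourier_add]
  rfl

/-- The Fourier transform on `W^{k,2} + W^{k+1,2}`. -/
noncomputable def sumFourier (d k : ℕ) : (sobolevCouple d k 2).SumSpace →L[ℂ] LTwo d :=
  (sobolevCouple d k 2).addKer.liftQL (pairFourier d k) fun x hx => by
    have hx' : (sobolevCouple d k 2).addMap x = 0 := hx
    apply lpEmb_injective d 2
    change lpEmb d 2 (pairFourier d k x) = lpEmb d 2 0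
    rw [lpEmb_pairFourier, hx', FourierTransform.fourier_zero, map_zero]

theorem lpEmb_sumFourier (k : ℕ) (w : (sobolevCouple d k 2).SumSpace) :
    lpEmb d 2 (sumFourier d k w) = 𝓕 ((sobolevCouple d k 2).toAmbient w) := by
  obtain ⟨x, rfl⟩ := Submodule.mkQ_surjective _ w
  exact lpEmb_pairFourier k x

theorem sumFourier_ofPair (k : ℕ) (u : SobolevSpace d k 2) (v : SobolevSpace d (k + 1) 2) :
    sumFourier d k ((sobolevCouple d k 2).ofPair u v) =
      sobolevFourier d k u + sobolevFourier d (k + 1) v := rfl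

/-- Only `Re w` affects the modulus, and the truncation lies below `log ⟨ξ⟩`, so the combined
multiplier has modulus at most `1`. This makes the boundary estimates independent of `n`. -/
theorem norm_mulOp_bracketOp_le {n : ℕ} {σ : ℝ} {w : ℂ} (hσ : 0 ≤ σ) (hw : w.re = σ)
    (g : LTwo d) :
    ‖mulOp (expSymbol (fun ξ => min (logBracket ξ) n) w) (bracketOp d σ g)‖ ≤ ‖g‖ := by
  have hm : MemLp (expSymbol (fun ξ : Rd d => min (logBracket ξ) n) w) ∞ volume :=
    memLp_expSymbol_min n w
  refine Lp.norm_le_norm_of_ae_le ?_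
  filter_upwards [coeFn_mulOp hm (bracketOp d σ g),
    coeFn_bracketOp (z := σ) (by simpa using hσ) g] with ξ h₁ h₂
  rw [h₁, h₂, ← mul_assoc, norm_mul, norm_mul, norm_expSymbol, norm_expSymbol, ← Real.exp_add, hw,
    Complex.neg_re, Complex.ofReal_re]
  refine mul_le_of_le_one_left (norm_nonneg _) (Real.exp_le_one_iff.mpr ?_)
  nlinarith [min_le_left (logBracket ξ) (n : ℝ)]

open Complex.HadamardThreeLines in
theorem exists_fourier_eq_of_stripFunction (d k : ℕ) : ∃ C : ℝ, 0 < C ∧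
    ∀ (f : (sobolevCouple d k 2).StripFunction) (θ : ℝ), 0 ≤ θ → θ ≤ 1 → ∃ g : LTwo d,
      𝓕 ((sobolevCouple d k 2).toAmbient (f.toFun θ)) =
        lpEmb d 2 (bracketOp d ((k + θ : ℝ) : ℂ) g) ∧ ‖g‖ ≤ C * f.fNorm := by
  obtain ⟨C₀, hC₀, h₀⟩ := exists_fourier_incl_eq_bracketOp d k
  obtain ⟨C₁, hC₁, h₁⟩ := exists_fourier_incl_eq_bracketOp d (k + 1)
  refine ⟨max C₀ C₁, lt_max_of_lt_left hC₀, fun f θ hθ₀ hθ₁ => ?_⟩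
  -- A real `⨆` dominates its terms only when the family is bounded; functions in `C₀` are.
  have hb₀ : ∀ y, ‖f.bdry₀ y‖ ≤ f.fNorm := fun y =>
    (le_ciSup (f := fun y => ‖f.bdry₀ y‖)
      ⟨‖f.bdry₀.toBCF‖, by rintro _ ⟨y, rfl⟩; exact f.bdry₀.toBCF.norm_coe_le_norm y⟩ y).trans
      (le_max_left _ _)
  have hb₁ : ∀ y, ‖f.bdry₁ y‖ ≤ f.fNorm := fun y =>
    (le_ciSup (f := fun y => ‖f.bdry₁ y‖)
      ⟨‖f.bdry₁.toBCF‖, by rintro _ ⟨y, rfl⟩; exact f.bdry₁.toBCF.norm_coe_le_norm y⟩ y).trans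
      (le_max_right _ _)
  have hN : 0 ≤ f.fNorm := (norm_nonneg _).trans (hb₀ 0)
  set K := max C₀ C₁ * f.fNorm with hK
  have hK0 : 0 ≤ K := by positivity
  let F : ℂ → LTwo d := fun z => sumFourier d k (f.toFun z)
  have hFc : ContinuousOn F BanachCouple.strip :=
    (sumFourier d k).continuous.comp_continuousOn f.continuousOn
  have hsub : BanachCouple.openStrip ⊆ BanachCouple.strip := fun z hz => ⟨hz.1.le, hz.2.le⟩
  have hopen : IsOpen BanachCouple.openStrip :=
    (isOpen_lt continuous_const Complex.continuous_re).inter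
      (isOpen_lt Complex.continuous_re continuous_const)
  have hFd : DifferentiableOn ℂ F BanachCouple.openStrip :=
    differentiableOn_of_forall_dual hopen (hFc.mono hsub)
      fun l => f.holomorphic (l.comp (sumFourier d k))
  obtain ⟨M, hM⟩ := f.bounded
  have hFb : ∀ z ∈ BanachCouple.strip, ‖F z‖ ≤ ‖sumFourier d k‖ * M := fun z hz =>
    ((sumFourier d k).le_opNorm _).trans (by gcongr; exact hM z hz)
  have hbound : ∀ n : ℕ,
      ‖mulOp (expSymbol (fun ξ => min (logBracket ξ) n) ((k + θ : ℝ) : ℂ)) (F θ)‖ ≤ K := by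
    intro n
    let G : ℂ → LTwo d := fun z =>
      mulOp (expSymbol (fun ξ => min (logBracket ξ) n) (k + z)) (F z)
    have hop : Differentiable ℂ fun z : ℂ =>
        mulOp (d := d) (expSymbol (fun ξ => min (logBracket ξ) n) (k + z)) := fun z =>
      (hasDerivAt_mulOp_expSymbol (measurable_min_logBracket n) (abs_min_logBracket_le n)
        (k + z)).differentiableAt.comp z (differentiableAt_id.const_add _)
    have hdc : DiffContOnCl ℂ G (verticalStrip 0 1) := by
      refine ⟨hop.differentiableOn.clm_apply hFd, ?_⟩
      rw [verticalStrip, Complex.closure_preimage_re, closure_Ioo zero_ne_one]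
      exact hop.continuous.continuousOn.clm_apply hFc
    have hbdd : BddAbove ((norm ∘ G) '' verticalClosedStrip 0 1) := by
      -- This bound grows with `n`, which is harmless: the three lines theorem needs finiteness
      -- inside the strip, and its conclusion involves the boundary bounds alone.
      refine ⟨Real.exp ((k + 1) * n) * (‖sumFourier d k‖ * M), ?_⟩
      rintro _ ⟨z, hz, rfl⟩
      refine (norm_mulOp_apply_le (memLp_expSymbol_min n _)
        (C := Real.exp ((k + 1) * n)) (fun ξ => ?_) _).trans ?_
      · refine (norm_expSymbol_le (abs_min_logBracket_le n) _ ξ).trans ?_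
        have hre : (k + z : ℂ).re = k + z.re := by simp
        rw [Real.exp_le_exp, hre, abs_of_nonneg (add_nonneg k.cast_nonneg hz.1)]
        gcongr
        exact hz.2
      · gcongr
        exact hFb z hz
    have hl : ∀ z ∈ Complex.re ⁻¹' {0}, ‖G z‖ ≤ K := by
      intro z hz
      have hz' : z.re = 0 := hz
      have hzy : z = Complex.I * z.im := Complex.ext (by simp [hz']) (by simp)
      obtain ⟨g, hg, hgn⟩ := h₀ (f.bdry₀ z.im)
      have hF : F z = bracketOp d (k : ℝ) g := by
        apply lpEmb_injective d 2
        rw [← hg, ← lpEmb_sobolevFourier]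
        simp only [F]
        rw [hzy, f.eq_bdry₀, sumFourier_ofPair, map_zero, add_zero, ← hzy]
      simp only [G]
      rw [hF]
      refine (norm_mulOp_bracketOp_le k.cast_nonneg (by simp [hz']) g).trans (hgn.trans ?_)
      exact mul_le_mul (le_max_left _ _) (hb₀ _) (norm_nonneg _) (by positivity)
    have hr : ∀ z ∈ Complex.re ⁻¹' {1}, ‖G z‖ ≤ K := by
      intro z hz
      have hz' : z.re = 1 := hz
      have hzy : z = 1 + Complex.I * z.im := Complex.ext (by simp [hz']) (by simp)
      obtain ⟨g, hg, hgn⟩ := h₁ (f.bdry₁ z.im)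
      have hF : F z = bracketOp d ((k + 1 : ℕ) : ℝ) g := by
        apply lpEmb_injective d 2
        rw [← hg, ← lpEmb_sobolevFourier]
        simp only [F]
        rw [hzy, f.eq_bdry₁, sumFourier_ofPair, map_zero, zero_add, ← hzy]
      simp only [G]
      rw [hF]
      refine (norm_mulOp_bracketOp_le (Nat.cast_nonneg _) (by simp [hz']) g).trans (hgn.trans ?_)
      exact mul_le_mul (le_max_right _ _) (hb₁ _) (norm_nonneg _) (by positivity)
    -- Both lines carry the same bound `K`, so the interpolated bound `K^{1-θ} K^θ` is again `K`.
    have hmain := norm_le_interp_of_mem_verticalClosedStrip₀₁' G (z := θ)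
      (by simpa [verticalClosedStrip] using ⟨hθ₀, hθ₁⟩) hdc hbdd hl hr
    rw [Complex.ofReal_re, ← Real.rpow_add' hK0 (by simp), sub_add_cancel, Real.rpow_one] at hmain
    simpa [G] using hmain
  obtain ⟨g, hg, hgn⟩ := exists_bracketOp_eq_of_bound (add_nonneg k.cast_nonneg hθ₀) (F θ) hK0 hbound
  exact ⟨g, by rw [← hg, lpEmb_sumFourier], hgn⟩

end sumFourier

/-! ### The extremal strip functions -/

section lift

variable {d : ℕ}

theorem norm_exp_sq (w : ℂ) : ‖Complex.exp (w ^ 2)‖ = Real.exp (w.re ^ 2 - w.im ^ 2) := by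
  rw [Complex.norm_exp, sq, Complex.mul_re, sq, sq]

/-- The function `y ↦ exp ((x + iy)²) c(y)` for a bounded continuous function `c`. -/
noncomputable def gaussianSMul {E : Type*} [NormedAddCommGroup E] [NormedSpace ℂ E] (x : ℝ)
    (c : ℝ → E) (hc : Continuous c) (M : ℝ) (hM : ∀ y, ‖c y‖ ≤ M) : C₀(ℝ, E) where
  toFun y := Complex.exp ((x + Complex.I * y) ^ 2) • c y
  continuous_toFun := by fun_prop
  zero_at_infty' := by
    have hsq : Tendsto (fun y : ℝ => y ^ 2) (cocompact ℝ) atTop := by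
      have h := (tendsto_pow_atTop (α := ℝ) two_ne_zero).comp (tendsto_norm_cocompact_atTop (E := ℝ))
      exact h.congr fun y => by simp
    have h0 : Tendsto (fun y : ℝ => Real.exp (x ^ 2 - y ^ 2) * M) (cocompact ℝ) (𝓝 0) := by
      have h := (Real.tendsto_exp_neg_atTop_nhds_zero.comp hsq).const_mul (Real.exp (x ^ 2) * M)
      rw [mul_zero] at h
      refine h.congr fun y => ?_
      rw [Function.comp_apply, sub_eq_add_neg, Real.exp_add]
      ring
    refine squeeze_zero_norm (fun y => ?_) h0
    rw [norm_smul, norm_exp_sq]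
    simp only [Complex.add_re, Complex.ofReal_re, Complex.mul_re, Complex.I_re, Complex.I_im,
      Complex.ofReal_im, Complex.add_im, Complex.mul_im]
    ring_nf
    gcongr
    exact hM y

theorem gaussianSMul_apply {E : Type*} [NormedAddCommGroup E] [NormedSpace ℂ E] (x : ℝ)
    (c : ℝ → E) (hc : Continuous c) (M : ℝ) (hM : ∀ y, ‖c y‖ ≤ M) (y : ℝ) :
    gaussianSMul x c hc M hM y = Complex.exp ((x + Complex.I * y) ^ 2) • c y := rfl

theorem norm_exp_sq_le {w : ℂ} (hw : |w.re| ≤ 1) : ‖Complex.exp (w ^ 2)‖ ≤ Real.exp 1 := by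
  rw [norm_exp_sq, Real.exp_le_exp]
  nlinarith [sq_nonneg w.im, (sq_le_one_iff_abs_le_one _).mpr hw]

theorem norm_gaussianSMul_apply_le {E : Type*} [NormedAddCommGroup E] [NormedSpace ℂ E] {x : ℝ}
    (hx : |x| ≤ 1) (c : ℝ → E) (hc : Continuous c) (M : ℝ) (hM : ∀ y, ‖c y‖ ≤ M) (y : ℝ) :
    ‖gaussianSMul x c hc M hM y‖ ≤ Real.exp 1 * M := by
  rw [gaussianSMul_apply, norm_smul]
  gcongr
  · exact norm_exp_sq_le (by simpa using hx)
  · exact hM y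

theorem continuous_bracketOp_I_mul (g : LTwo d) :
    Continuous fun y : ℝ => bracketOp d (Complex.I * y) g :=
  (bracketOp_apply_regularity g).1.comp_continuous (by fun_prop) fun y => by simp

theorem norm_clm_bracketOp_le {E : Type*} [NormedAddCommGroup E] [NormedSpace ℂ E]
    (R : LTwo d →L[ℂ] E) (g : LTwo d) {z : ℂ} (hz : 0 ≤ z.re) :
    ‖R (bracketOp d z g)‖ ≤ ‖R‖ * ‖g‖ :=
  (R.le_opNorm _).trans (by gcongr; exact norm_bracketOp_apply_le hz g)

/-- The inclusion of `W^{k,2}` in `W^{k,2} + W^{k+1,2}`. -/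
noncomputable def ofLeft (d k : ℕ) :
    SobolevSpace d k 2 →L[ℂ] (sobolevCouple d k 2).SumSpace :=
  ((sobolevCouple d k 2).addKer.mkQL).comp
    (((WithLp.prodContinuousLinearEquiv 1 ℂ (SobolevSpace d k 2)
      (SobolevSpace d (k + 1) 2)).symm : _ →L[ℂ] _).comp
      (ContinuousLinearMap.inl ℂ (SobolevSpace d k 2) (SobolevSpace d (k + 1) 2)))

theorem ofLeft_apply (k : ℕ) (u : SobolevSpace d k 2) :
    ofLeft d k u = (sobolevCouple d k 2).ofPair u 0 := rfl

/-- Both sides have Fourier transform `⟨ξ⟩^{-k-1-z} g`. This places the `W^{k,2}`-valued curve in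
`W^{k+1,2}` on the line `Re z = 1`. -/
theorem sobolevLiftCLM_bracketOp_one_add (k : ℕ) {z : ℂ} (hz : 0 ≤ z.re) (g : LTwo d) :
    SobolevSpace.incl d k 2 (sobolevLiftCLM d k (bracketOp d (1 + z) g)) =
      SobolevSpace.incl d (k + 1) 2 (sobolevLiftCLM d (k + 1) (bracketOp d z g)) := by
  apply fourier_injective
  simp only
  rw [fourier_incl_sobolevLiftCLM, fourier_incl_sobolevLiftCLM,
    bracketOp_bracketOp (by simp) (by rw [Complex.add_re, Complex.one_re]; positivity),
    bracketOp_bracketOp (by simp; positivity) hz]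
  push_cast
  rw [add_assoc]

/-- The curve `z ↦ exp ((z - θ)²) 𝓕⁻¹ (⟨ξ⟩^{-k-z} g)` in `W^{k,2}`. -/
noncomputable def liftCurve (k : ℕ) (θ : ℝ) (g : LTwo d) (z : ℂ) : SobolevSpace d k 2 :=
  Complex.exp ((z - θ) ^ 2) • sobolevLiftCLM d k (bracketOp d z g)

theorem continuousOn_liftCurve (k : ℕ) (θ : ℝ) (g : LTwo d) :
    ContinuousOn (liftCurve k θ g) BanachCouple.strip := by
  have h : ContinuousOn (fun z => bracketOp d z g) BanachCouple.strip :=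
    (bracketOp_apply_regularity g).1.mono fun z hz => hz.1
  have he : Continuous fun z : ℂ => Complex.exp ((z - θ) ^ 2) := by fun_prop
  exact he.continuousOn.smul ((sobolevLiftCLM d k).continuous.comp_continuousOn h)

theorem differentiableOn_liftCurve (k : ℕ) (θ : ℝ) (g : LTwo d) :
    DifferentiableOn ℂ (liftCurve k θ g) BanachCouple.openStrip := by
  have h : DifferentiableOn ℂ (fun z => bracketOp d z g) BanachCouple.openStrip :=
    (bracketOp_apply_regularity g).2.mono fun z hz => hz.1
  have he : Differentiable ℂ fun z : ℂ => Complex.exp ((z - θ) ^ 2) := by fun_prop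
  exact he.differentiableOn.smul ((sobolevLiftCLM d k).differentiable.comp_differentiableOn h)

theorem norm_liftCurve_le (k : ℕ) (θ : ℝ) (g : LTwo d) {z : ℂ} (hz : z ∈ BanachCouple.strip) :
    ‖liftCurve k θ g z‖ ≤ Real.exp ((1 + |θ|) ^ 2) * (‖sobolevLiftCLM d k‖ * ‖g‖) := by
  rw [liftCurve, norm_smul, norm_exp_sq]
  gcongr
  · have h : |(z - θ).re| ≤ 1 + |θ| := by
      rw [Complex.sub_re, Complex.ofReal_re]
      refine (abs_sub _ _).trans ?_
      gcongr
      rw [abs_of_nonneg hz.1]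
      exact hz.2
    nlinarith [sq_nonneg (z - θ).im, sq_abs (z - θ).re, abs_nonneg (z - θ).re]
  · exact norm_clm_bracketOp_le _ g hz.1

/-- The boundary function `y ↦ exp ((x + iy)²) 𝓕⁻¹ (⟨ξ⟩^{-k-iy} g)` in `C₀(ℝ, W^{k,2})`. -/
noncomputable def liftBoundary (k : ℕ) (x : ℝ) (g : LTwo d) : C₀(ℝ, SobolevSpace d k 2) :=
  gaussianSMul x (fun y => sobolevLiftCLM d k (bracketOp d (Complex.I * y) g))
    ((sobolevLiftCLM d k).continuous.comp (continuous_bracketOp_I_mul g))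
    (‖sobolevLiftCLM d k‖ * ‖g‖) (fun y => norm_clm_bracketOp_le _ g (by simp))

theorem liftBoundary_apply (k : ℕ) (x : ℝ) (g : LTwo d) (y : ℝ) :
    liftBoundary k x g y = Complex.exp ((x + Complex.I * y) ^ 2) •
      sobolevLiftCLM d k (bracketOp d (Complex.I * y) g) := rfl

theorem norm_liftBoundary_apply_le (k : ℕ) {x : ℝ} (hx : |x| ≤ 1) (g : LTwo d) (y : ℝ) :
    ‖liftBoundary k x g y‖ ≤ Real.exp 1 * (‖sobolevLiftCLM d k‖ * ‖g‖) :=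
  norm_gaussianSMul_apply_le hx _ _ _ _ y

theorem liftCurve_I_mul (k : ℕ) (θ : ℝ) (g : LTwo d) (y : ℝ) :
    liftCurve k θ g (Complex.I * y) = liftBoundary k (-θ) g y := by
  rw [liftCurve, liftBoundary_apply, Complex.ofReal_neg, neg_add_eq_sub]

theorem incl_liftCurve_one_add (k : ℕ) (θ : ℝ) (g : LTwo d) (y : ℝ) :
    SobolevSpace.incl d k 2 (liftCurve k θ g (1 + Complex.I * y)) =
      SobolevSpace.incl d (k + 1) 2 (liftBoundary (k + 1) (1 - θ) g y) := by
  rw [liftCurve, liftBoundary_apply, map_smul, map_smul,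
    sobolevLiftCLM_bracketOp_one_add k (by simp) g, Complex.ofReal_sub, Complex.ofReal_one,
    add_sub_right_comm]

/-- The strip function `z ↦ exp ((z - θ)²) 𝓕⁻¹ (⟨ξ⟩^{-k-z} g)`. -/
noncomputable def liftStripFunction (k : ℕ) (θ : ℝ) (g : LTwo d) :
    (sobolevCouple d k 2).StripFunction where
  toFun z := ofLeft d k (liftCurve k θ g z)
  bdry₀ := liftBoundary k (-θ) g
  bdry₁ := liftBoundary (k + 1) (1 - θ) g
  continuousOn := (ofLeft d k).continuous.comp_continuousOn (continuousOn_liftCurve k θ g)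
  bounded := ⟨_, fun _ hz => ((ofLeft d k).le_opNorm _).trans
    (mul_le_mul_of_nonneg_left (norm_liftCurve_le k θ g hz) (norm_nonneg _))⟩
  holomorphic l := (l.comp (ofLeft d k)).differentiable.comp_differentiableOn
    (differentiableOn_liftCurve k θ g)
  eq_bdry₀ y := by rw [liftCurve_I_mul, ofLeft_apply]
  eq_bdry₁ y := by
    -- The two sides come from different summands of the couple, so they are compared as tempered
    -- distributions.
    apply (sobolevCouple d k 2).toAmbient_injective
    rw [ofLeft_apply, BanachCouple.toAmbient_ofPair, BanachCouple.toAmbient_ofPair,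
      map_zero, map_zero, add_zero, zero_add]
    exact incl_liftCurve_one_add k θ g y

theorem fourier_toAmbient_liftStripFunction (k : ℕ) {θ : ℝ} (hθ : 0 ≤ θ) (g : LTwo d) :
    𝓕 ((sobolevCouple d k 2).toAmbient ((liftStripFunction k θ g).toFun θ)) =
      lpEmb d 2 (bracketOp d ((k + θ : ℝ) : ℂ) g) := by
  have h : (sobolevCouple d k 2).toAmbient ((liftStripFunction k θ g).toFun θ) =
      SobolevSpace.incl d k 2 (sobolevLiftCLM d k (bracketOp d θ g)) := by
    change (sobolevCouple d k 2).toAmbient (ofLeft d k (liftCurve k θ g θ)) = _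
    rw [ofLeft_apply, BanachCouple.toAmbient_ofPair, map_zero, add_zero, liftCurve, sub_self,
      zero_pow two_ne_zero, Complex.exp_zero, one_smul]
    rfl
  rw [h, fourier_incl_sobolevLiftCLM, bracketOp_bracketOp (by simp) (by simpa using hθ)]
  push_cast
  rfl

/-- On the two lines `z - θ` has real part `-θ` or `1 - θ`, of modulus at most `1`, so the Gaussian
factor is at most `e`. -/
theorem fNorm_liftStripFunction_le (k : ℕ) {θ : ℝ} (hθ₀ : 0 ≤ θ) (hθ₁ : θ ≤ 1) (g : LTwo d) :
    (liftStripFunction k θ g).fNorm ≤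
      Real.exp 1 * (‖sobolevLiftCLM d k‖ + ‖sobolevLiftCLM d (k + 1)‖) * ‖g‖ := by
  rw [mul_assoc, add_mul]
  refine max_le (ciSup_le fun y => ?_) (ciSup_le fun y => ?_)
  · refine (norm_liftBoundary_apply_le _ (abs_le.mpr ⟨by linarith, by linarith⟩) g y).trans ?_
    gcongr
    exact le_add_of_nonneg_right (by positivity)
  · refine (norm_liftBoundary_apply_le _ (abs_le.mpr ⟨by linarith, by linarith⟩) g y).trans ?_
    gcongr
    exact le_add_of_nonneg_left (by positivity)

end lift

/-! ### Equality of the spaces and equivalence of the norms. -/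

theorem BanachCouple.StripFunction.fNorm_nonneg {B₀ B₁ V : Type*}
    [NormedAddCommGroup B₀] [NormedSpace ℂ B₀] [CompleteSpace B₀]
    [NormedAddCommGroup B₁] [NormedSpace ℂ B₁] [CompleteSpace B₁]
    [AddCommGroup V] [Module ℂ V] [TopologicalSpace V] [T2Space V]
    [IsTopologicalAddGroup V] [ContinuousSMul ℂ V] {C : BanachCouple B₀ B₁ V}
    (f : C.StripFunction) : 0 ≤ f.fNorm :=
  le_max_of_le_left (Real.iSup_nonneg fun _ => norm_nonneg _)

theorem sobolevSubmodule_eq_hSubmodule (d k : ℕ) :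
    sobolevSubmodule d k 2 = hSubmodule d k ∧
      ∃ c C : ℝ, 0 < c ∧ 0 < C ∧ ∀ (u : SobolevSpace d k 2) (v : hSubmodule d k),
        SobolevSpace.incl d k 2 u = (v : 𝓢'(Rd d, ℂ)) →
          c * hNorm v ≤ ‖u‖ ∧ ‖u‖ ≤ C * hNorm v := by
  have hk : (0 : ℝ) ≤ k := k.cast_nonneg
  obtain ⟨C, hC, h⟩ := exists_fourier_incl_eq_bracketOp d k
  have hlift : ∀ (v : 𝓢'(Rd d, ℂ)) (g : LTwo d), weightedFourier d k v = lpEmb d 2 g →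
      SobolevSpace.incl d k 2 (sobolevLiftCLM d k g) = v := fun v g hg => by
    apply fourier_injective
    simp only
    rw [fourier_incl_sobolevLiftCLM, (weightedFourier_eq_lpEmb_iff hk v g).mp hg]
  -- The added `1` keeps the upper constant positive without showing that the lift is nonzero.
  refine ⟨le_antisymm (fun u hu => ?_) ?_, C⁻¹, ‖sobolevLiftCLM d k‖ + 1, by positivity,
    by positivity, fun u v huv => ⟨?_, ?_⟩⟩
  · obtain ⟨g, hg, -⟩ := h ⟨u, hu⟩
    exact ⟨g, (weightedFourier_eq_lpEmb_iff hk u g).mpr hg⟩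
  · rintro v ⟨g, hg⟩
    rw [← hlift v g hg]
    exact (sobolevLiftCLM d k g).2
  · obtain ⟨g, hg, hn⟩ := h u
    rw [huv] at hg
    rwa [hNorm_eq v g ((weightedFourier_eq_lpEmb_iff hk _ g).mpr hg), inv_mul_le_iff₀ hC]
  · obtain ⟨g, hg⟩ := v.2
    have hu : u = sobolevLiftCLM d k g :=
      SobolevSpace.incl_injective (huv.trans (hlift v g hg).symm)
    rw [hNorm_eq v g hg, hu]
    refine ((sobolevLiftCLM d k).le_opNorm g).trans ?_
    gcongr
    linarith

theorem interp_sobolevCouple_eq_hSubmodule (d k : ℕ) {θ : ℝ} (hθ₀ : 0 ≤ θ) (hθ₁ : θ ≤ 1) :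
    (sobolevCouple d k 2).interp θ = hSubmodule d (k + θ) ∧
      ∃ c C : ℝ, 0 < c ∧ 0 < C ∧ ∀ v : hSubmodule d (k + θ),
        c * hNorm v ≤ (sobolevCouple d k 2).interpNorm θ (v : 𝓢'(Rd d, ℂ)) ∧
          (sobolevCouple d k 2).interpNorm θ (v : 𝓢'(Rd d, ℂ)) ≤ C * hNorm v := by
  have hs : 0 ≤ (k : ℝ) + θ := add_nonneg k.cast_nonneg hθ₀
  obtain ⟨C, hC, h⟩ := exists_fourier_eq_of_stripFunction d k
  have hlift : ∀ (v : 𝓢'(Rd d, ℂ)) (g : LTwo d), weightedFourier d (k + θ) v = lpEmb d 2 g →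
      (sobolevCouple d k 2).toAmbient ((liftStripFunction k θ g).toFun θ) = v := fun v g hg => by
    apply fourier_injective
    simp only
    rw [fourier_toAmbient_liftStripFunction k hθ₀, (weightedFourier_eq_lpEmb_iff hs v g).mp hg]
  refine ⟨le_antisymm ?_ ?_, C⁻¹,
    Real.exp 1 * (‖sobolevLiftCLM d k‖ + ‖sobolevLiftCLM d (k + 1)‖) + 1, by positivity,
    by positivity, fun v => ⟨?_, ?_⟩⟩
  · rintro _ ⟨f, rfl⟩
    obtain ⟨g, hg, -⟩ := h f θ hθ₀ hθ₁
    exact ⟨g, (weightedFourier_eq_lpEmb_iff hs _ g).mpr hg⟩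
  · rintro v ⟨g, hg⟩
    exact ⟨_, hlift v g hg⟩
  · obtain ⟨g₀, hg₀⟩ := v.2
    -- The infimum over an empty set would be `0`; the extremal strip function shows that the set is
    -- nonempty.
    refine le_csInf ⟨_, _, hlift v g₀ hg₀, rfl⟩ ?_
    rintro _ ⟨f, hf, rfl⟩
    obtain ⟨g, hg, hn⟩ := h f θ hθ₀ hθ₁
    rw [hf] at hg
    rwa [hNorm_eq v g ((weightedFourier_eq_lpEmb_iff hs _ g).mpr hg), inv_mul_le_iff₀ hC]
  · obtain ⟨g, hg⟩ := v.2
    have hle : (sobolevCouple d k 2).interpNorm θ (v : 𝓢'(Rd d, ℂ)) ≤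
        (liftStripFunction k θ g).fNorm := by
      refine csInf_le ⟨0, ?_⟩ ⟨_, hlift v g hg, rfl⟩
      rintro _ ⟨f, -, rfl⟩
      exact f.fNorm_nonneg
    rw [hNorm_eq v g hg]
    refine (hle.trans (fNorm_liftStripFunction_le k hθ₀ hθ₁ g)).trans ?_
    gcongr
    linarith

theorem mainTheorem9 (d : ℕ) (s : ℝ) (hs : 0 ≤ s) :
    (∀ k : ℕ, s = k →
      sobolevSubmodule d k 2 = hSubmodule d s ∧
      ∃ c C : ℝ, 0 < c ∧ 0 < C ∧
        ∀ (u : SobolevSpace d k 2) (v : hSubmodule d s),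
          SobolevSpace.incl d k 2 u = (v : 𝓢'(Rd d, ℂ)) →
            c * hNorm v ≤ ‖u‖ ∧ ‖u‖ ≤ C * hNorm v) ∧
    (∀ (k : ℕ) (θ : ℝ), 0 ≤ θ → θ ≤ 1 → s = (1 - θ) * k + θ * (k + 1) →
      (sobolevCouple d k 2).interp θ = hSubmodule d s ∧
      ∃ c C : ℝ, 0 < c ∧ 0 < C ∧
        ∀ v : hSubmodule d s,
          c * hNorm v ≤ (sobolevCouple d k 2).interpNorm θ (v : 𝓢'(Rd d, ℂ)) ∧
          (sobolevCouple d k 2).interpNorm θ (v : 𝓢'(Rd d, ℂ)) ≤ C * hNorm v) := by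
  constructor
  · rintro k rfl
    exact sobolevSubmodule_eq_hSubmodule d k
  · intro k θ hθ₀ hθ₁ hsk
    obtain rfl : s = k + θ := by rw [hsk]; ring
    exact interp_sobolevCouple_eq_hSubmodule d k hθ₀ hθ₁
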